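/- **Setting.** Let $\alpha,\beta>0$ and $L\in\{1,2,\dots\}$. Let $\mathcal V$ be the set of sequences $v=(v(k))_{k\ge0}$ with $v(0)=1$, $v(k)\ge v(k+1)$ and $\lim_k v(k)=0$. For $v\in\mathcal V$ and $k\ge1$ put $F_+(v)(k)=\alpha\,(v(k-1)^L-v(k)^L)$, $F_-(v)(k)=\beta\,(v(k)-v(k+1))$, $F_\pm(v)(0)=0$, and, for a sequence $x$ with $x(0)=0$, $$\mathbf K(v)x(k)=\alpha L\,v(k-1)^{L-1}x(k-1)-\bigl(\alpha L\,v(k)^{L-1}+\beta\bigr)x(k)+\beta\,x(k+1),\qquad \mathbf K(v)x(0)=0 .$$ Let $w=(w(k))_{k\ge1}$ be a positive sequence such that for some $c,d>0$ one has $c\,w(k+1)\le w(k)\le d\,w(k+1)$ for all $k\ge1$. Let $L_2(w)$ be the Hilbert space of real sequences $x$ with $x(0)=0$ and $\|x\|^2_{L_2(w)}=\sum_{k\ge1}x(k)^2w(k)^{-1}<\infty$. For $v\in\mathcal V$ we write $v\in L_2(w)$ if $\sum_{k\ge1}v(k)^2w(k)^{-1}<\infty$ and $v\in\ell_1(w)$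 if $\sum_{k\ge1}v(k)w(k)^{-1}<\infty$. Let $u=(u_t)_{t\ge0}$ be a $\mathcal V$-valued solution of $\dot u_t=F_+(u_t)-F_-(u_t)$ (coordinatewise). Let $M=(M(k))_{k\ge0}$ be independent real continuous centered Gaussian martingales on a probability space, null at time $0$, with Doob–Meyer brackets $\langle M(k)\rangle_t=\int_0^t\{F_+(u_s)(k)+F_-(u_s)(k)\}\,ds$. Let $Z_0$ be an $L_2(w)$-valued random variable. The Ornstein–Uhlenbeck equation in $L_2(w)$ is $$Z_t=Z_0+\int_0^t\mathbf K(u_s)Z_s\,ds+M_t,\qquad t\ge0. \tag{OU}$$ For $0\le s\le t$, $\mathrm e^{\int_s^t\mathbf K(u_r)dr}$ denotes the time-ordered exponential $$\mathrm e^{\int_s^t\mathbf K(u_r)dr}=\sum_{n\ge0}\ \int_{s\le r_1\le\cdots\le r_n\le t}\mathbf K(u_{r_n})\cdots\mathbf K(u_{r_1})\,dr_1\cdots dr_n$$ on $L_2(w)$. **Theorem.** (a) For $v\in\mathcal V$, $\mathbf K(v)$ is a bounded operator on $L_2(w)$, with operator norm bounded uniformly in $v\in\mathcal V$. (b) Let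 $u_0\in\mathcal V\cap L_2(w)$. For every $z_0\in L_2(w)$, $z_t=\mathrm e^{\int_0^t\mathbf K(u_s)ds}z_0$ is the unique solution in $L_2(w)$ of $\dot z_t=\mathbf K(u_t)z_t$, $t\ge0$, starting at $z_0$. For $0\le s\le t$, if the operators $\mathbf K(u_r)$, $s\le r\le t$, commute, then $\mathrm e^{\int_s^t\mathbf K(u_r)dr}$ is the usual exponential series of the bounded operator $\int_s^t\mathbf K(u_r)\,dr$. Strong (pathwise) uniqueness holds for (OU): two solutions in $L_2(w)$ on the same probability space with the same $M$ and $Z_0$ are almost surely equal for all $t\ge0$. (c) Let $u_0\in\mathcal V\cap\ell_1(w)$. Then there is a unique strong solution of (OU) in $L_2(w)$, that is, one adapted to the completed filtration generated by $Z_0$ and $M$. It has continuous paths and is given by $$Z_t=\mathrm e^{\int_0^t\mathbf K(u_s)ds}Z_0+\int_0^t\mathrm e^{\int_s^t\mathbf K(u_r)dr}\,dM_s ,$$ where the stochastic integral is the limit in probability of its left-endpoint Riemann sums. If $\mathbf E\bigl(\|Z_0\|_{L_2(w)}^2\bigr)<\infty$, then $\mathbf E\bigl(\sup_{0\le t\le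 T}\|Z_t\|_{L_2(w)}^2\bigr)<\infty$ for every $T\ge0$. -/

import Mathlib

open MeasureTheory ProbabilityTheory Filter Topology
open scoped NNReal ENNReal

noncomputable section

namespace SupermarketOU

/-! ### The weighted Hilbert space `L₂(w)` -/

/-- A sequence `w = (w(k))_{k ≥ 1}` of positive weights (the value at `0` is never used). -/
structure Weight where
  /-- the underlying sequence -/
  toFun : ℕ → ℝ
  pos' : ∀ k, 1 ≤ k → 0 < toFun k

instance : CoeFun Weight (fun _ => ℕ → ℝ) := ⟨Weight.toFun⟩

theorem Weight.pos (w : Weight) (k : ℕ) : 0 < w (k + 1) := w.pos' (k + 1) (Nat.le_add_left 1 k)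

/-- There are `c, d > 0` with `0 < c w(k+1) ≤ w(k) ≤ d w(k+1)` for all `k ≥ 1`. -/
def Weight.Comparable (w : Weight) : Prop :=
  ∃ c d : ℝ, 0 < c ∧ 0 < d ∧ ∀ k, 1 ≤ k → c * w (k + 1) ≤ w k ∧ w k ≤ d * w (k + 1)

/-- `∑_{k ≥ 1} x(k)² w(k)⁻¹ < ∞`. -/
def SqSummable (w : Weight) (x : ℕ → ℝ) : Prop :=
  Summable fun k : ℕ => x (k + 1) ^ 2 / w (k + 1)

/-- `∑_{k ≥ 1} |x(k)| w(k)⁻¹ < ∞`. -/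
def AbsSummable (w : Weight) (x : ℕ → ℝ) : Prop :=
  Summable fun k : ℕ => |x (k + 1)| / w (k + 1)

theorem SqSummable.mul {w : Weight} {x y : ℕ → ℝ} (hx : SqSummable w x) (hy : SqSummable w y) :
    Summable fun k : ℕ => x (k + 1) * y (k + 1) / w (k + 1) := by
  refine Summable.of_norm_bounded (Summable.add hx hy) fun k => ?_
  have hw := w.pos k
  rw [Real.norm_eq_abs, abs_div, abs_of_pos hw, ← add_div]
  refine div_le_div_of_nonneg_right ?_ hw.le
  rw [abs_le]
  constructor <;> nlinarith [sq_nonneg (x (k + 1) + y (k + 1)), sq_nonneg (x (k + 1) - y (k + 1)),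
    sq_nonneg (x (k + 1)), sq_nonneg (y (k + 1))]

/-- `L₂(w)` as a linear subspace of the space of real sequences. -/
def l2Submodule (w : Weight) : Submodule ℝ (ℕ → ℝ) where
  carrier := {x | x 0 = 0 ∧ SqSummable w x}
  zero_mem' := ⟨rfl, by simp [SqSummable]⟩
  add_mem' := by
    rintro x y ⟨hx0, hx⟩ ⟨hy0, hy⟩
    refine ⟨by simp [hx0, hy0], ?_⟩
    have h := (Summable.add hx hy).add ((hx.mul hy).mul_left 2)
    refine h.congr fun k => ?_
    simp only [Pi.add_apply]
    ring
  smul_mem' := by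
    rintro r x ⟨hx0, hx⟩
    refine ⟨by simp [hx0], ?_⟩
    refine (Summable.mul_left (r ^ 2) hx).congr fun k => ?_
    simp only [Pi.smul_apply, smul_eq_mul]
    ring

/-- The Hilbert space `L₂(w)`: sequences `x` with `x(0) = 0` and
`‖x‖² = ∑_{k ≥ 1} x(k)² w(k)⁻¹ < ∞`. -/
def L2 (w : Weight) : Type := l2Submodule w

variable {w : Weight}

section Algebra

/-- Termwise addition on `L₂(w)`. -/
@[reducible] def L2.addCommGroup (w : Weight) : AddCommGroup (L2 w) :=
  inferInstanceAs (AddCommGroup (l2Submodule w))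

attribute [local instance] L2.addCommGroup

/-- Termwise scalar multiplication on `L₂(w)`. -/
@[reducible] def L2.module (w : Weight) : Module ℝ (L2 w) :=
  inferInstanceAs (Module ℝ (l2Submodule w))

attribute [local instance] L2.module

/-- The sequence underlying an element of `L₂(w)`. -/
def L2.seq (x : L2 w) : ℕ → ℝ := (show l2Submodule w from x).1

theorem L2.seq_injective : Function.Injective (L2.seq : L2 w → ℕ → ℝ) := Subtype.val_injective

theorem L2.seq_zero_idx (x : L2 w) : x.seq 0 = 0 := (show l2Submodule w from x).2.1

theorem L2.sqSummable (x : L2 w) : SqSummable w x.seq := (show l2Submodule w from x).2.2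

/-- The scalar product `(x, y) = ∑_{k ≥ 1} x(k) y(k) w(k)⁻¹`. -/
@[reducible] def innerCore (w : Weight) : InnerProductSpace.Core ℝ (L2 w) where
  inner x y := ∑' k : ℕ, x.seq (k + 1) * y.seq (k + 1) / w (k + 1)
  conj_inner_symm x y := by simp [mul_comm]
  re_inner_nonneg x := by
    simpa using tsum_nonneg fun k => div_nonneg (mul_self_nonneg (x.seq (k + 1))) (w.pos k).le
  add_left x y z := by
    rw [← Summable.tsum_add (x.sqSummable.mul z.sqSummable) (y.sqSummable.mul z.sqSummable)]
    refine tsum_congr fun k => ?_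
    change (x.seq (k + 1) + y.seq (k + 1)) * _ / _ = _
    ring
  smul_left x y r := by
    simp only [conj_trivial]
    rw [← tsum_mul_left]
    refine tsum_congr fun k => ?_
    change (r * x.seq (k + 1)) * _ / _ = _
    ring
  definite x hx := by
    have hnn : ∀ k : ℕ, 0 ≤ x.seq (k + 1) * x.seq (k + 1) / w (k + 1) :=
      fun k => div_nonneg (mul_self_nonneg _) (w.pos k).le
    have h0 := (x.sqSummable.mul x.sqSummable).hasSum
    rw [show (∑' k : ℕ, x.seq (k + 1) * x.seq (k + 1) / w (k + 1)) = 0 from hx,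
      hasSum_zero_iff_of_nonneg hnn] at h0
    apply L2.seq_injective
    funext k
    cases k with
    | zero => exact x.seq_zero_idx
    | succ k =>
      have hk := congrFun h0 k
      simp only [Pi.zero_apply, div_eq_zero_iff, mul_self_eq_zero] at hk
      exact hk.resolve_right (w.pos k).ne'

instance : NormedAddCommGroup (L2 w) := (innerCore w).toNormedAddCommGroup

instance : InnerProductSpace ℝ (L2 w) := InnerProductSpace.ofCore (innerCore w).toCore

end Algebra

theorem L2.seq_add (x y : L2 w) : (x + y).seq = x.seq + y.seq := rfl

theorem L2.seq_smul (r : ℝ) (x : L2 w) : (r • x).seq = r • x.seq := rfl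

theorem L2.seq_zero : (0 : L2 w).seq = 0 := rfl

theorem L2.norm_sq (x : L2 w) : ‖x‖ ^ 2 = ∑' k : ℕ, x.seq (k + 1) ^ 2 / w (k + 1) := by
  rw [← real_inner_self_eq_norm_sq]
  exact tsum_congr fun k => by rw [sq]

theorem memlp_scaled (x : L2 w) :
    Memℓp (fun k : ℕ => x.seq (k + 1) / Real.sqrt (w (k + 1))) 2 := by
  refine memℓp_gen ?_
  refine x.sqSummable.congr fun k => ?_
  simp [div_pow, Real.sq_sqrt (w.pos k).le]

/-- `x ↦ (x(k) w(k)^{-1/2})_{k ≥ 1}` is a linear isometry from `L₂(w)` to `ℓ₂`. -/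
def toEll2 (w : Weight) : L2 w →ₗᵢ[ℝ] lp (fun _ : ℕ => ℝ) 2 where
  toFun x := ⟨fun k => x.seq (k + 1) / Real.sqrt (w (k + 1)), memlp_scaled x⟩
  map_add' x y := by
    apply Subtype.ext
    funext k
    exact add_div _ _ _
  map_smul' r x := by
    apply Subtype.ext
    funext k
    exact mul_div_assoc _ _ _
  norm_map' x := by
    refine (sq_eq_sq₀ (norm_nonneg _) (norm_nonneg _)).1 ?_
    rw [L2.norm_sq]
    have h := lp.norm_rpow_eq_tsum (p := 2) (by norm_num)
      (⟨fun k => x.seq (k + 1) / Real.sqrt (w (k + 1)), memlp_scaled x⟩ : lp (fun _ : ℕ => ℝ) 2)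
    simp only [ENNReal.toReal_ofNat, Real.rpow_ofNat] at h
    refine h.trans (tsum_congr fun k => ?_)
    simp [div_pow, Real.sq_sqrt (w.pos k).le]

theorem toEll2_surjective (w : Weight) : Function.Surjective (toEll2 w) := by
  intro y
  have hy := lp.memℓp y
  rw [memℓp_gen_iff (by norm_num)] at hy
  let x : ℕ → ℝ := fun n => Nat.casesOn n 0 fun k => y k * Real.sqrt (w (k + 1))
  have hx : SqSummable w x := by
    refine hy.congr fun k => ?_
    have h := (w.pos k).ne'
    simp [x, mul_pow, Real.sq_sqrt (w.pos k).le, h]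
  refine ⟨(show L2 w from (⟨x, rfl, hx⟩ : l2Submodule w)), ?_⟩
  apply Subtype.ext
  funext k
  have h : Real.sqrt (w (k + 1)) ≠ 0 := (Real.sqrt_pos.2 (w.pos k)).ne'
  exact mul_div_cancel_right₀ _ h

instance : CompleteSpace (L2 w) :=
  ((LinearIsometryEquiv.ofSurjective (toEll2 w) (toEll2_surjective w)).toIsometryEquiv.completeSpace_iff).2
    inferInstance

open Classical in
/-- A sequence viewed in `L₂(w)` (and `0` if it does not belong to `L₂(w)`). -/
def toL2 (w : Weight) (x : ℕ → ℝ) : L2 w :=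
  if h : x ∈ l2Submodule w then (show L2 w from (⟨x, h⟩ : l2Submodule w)) else 0

theorem toL2_seq {x : ℕ → ℝ} (h0 : x 0 = 0) (h : SqSummable w x) : (toL2 w x).seq = x := by
  have hx : x ∈ l2Submodule w := ⟨h0, h⟩
  have h2 : toL2 w x = (show L2 w from (⟨x, hx⟩ : l2Submodule w)) := dif_pos hx
  rw [h2]
  rfl

/-! ### The limit equation and its linearization -/

/-- `𝒱`: non-increasing sequences with `v(0) = 1` and limit `0`. -/
def tails : Set (ℕ → ℝ) :=
  {v | v 0 = 1 ∧ (∀ k, v (k + 1) ≤ v k) ∧ Tendsto v atTop (𝓝 0)}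

/-- `F₊(v)(k) = α (v(k-1)^L - v(k)^L)` for `k ≥ 1`. -/
def Fplus (α : ℝ) (L : ℕ) (v : ℕ → ℝ) : ℕ → ℝ
  | 0 => 0
  | k + 1 => α * (v k ^ L - v (k + 1) ^ L)

/-- `F₋(v)(k) = β (v(k) - v(k+1))` for `k ≥ 1`. -/
def Fminus (β : ℝ) (v : ℕ → ℝ) : ℕ → ℝ
  | 0 => 0
  | k + 1 => β * (v (k + 1) - v (k + 2))

/-- `u = (u_t)_{t ≥ 0}` takes values in `𝒱` and solves `u̇ = F₊(u) - F₋(u)` (values of `u` at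
negative times are irrelevant). -/
structure IsLimitSolution (α β : ℝ) (L : ℕ) (u : ℝ → ℕ → ℝ) : Prop where
  mem : ∀ t, 0 ≤ t → u t ∈ tails
  deriv : ∀ t, 0 ≤ t → ∀ k,
    HasDerivWithinAt (fun s => u s k) (Fplus α L (u t) k - Fminus β (u t) k) (Set.Ici 0) t

/-- The infinite matrix `K(v)` acting on sequences: for `k ≥ 1`,
`K(v)x(k) = α L v(k-1)^{L-1} x(k-1) - (α L v(k)^{L-1} + β) x(k) + β x(k+1)`. -/
def Kseq (α β : ℝ) (L : ℕ) (v x : ℕ → ℝ) : ℕ → ℝ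
  | 0 => 0
  | k + 1 => α * L * v k ^ (L - 1) * x k - (α * L * v (k + 1) ^ (L - 1) + β) * x (k + 1)
      + β * x (k + 2)

open Classical in
/-- `K(v)` as a bounded operator on `L₂(w)` (and `0` if it is not one). -/
def KOp (α β : ℝ) (L : ℕ) (w : Weight) (v : ℕ → ℝ) : L2 w →L[ℝ] L2 w :=
  if h : ∃ T : L2 w →L[ℝ] L2 w, ∀ x, (T x).seq = Kseq α β L v x.seq then h.choose else 0

/-- `z` solves `ż_t = K(u_t) z_t`, `t ≥ 0`, in `L₂(w)`. -/
def IsLinearizedSolution (α β : ℝ) (L : ℕ) (w : Weight) (u : ℝ → ℕ → ℝ) (z : ℝ → L2 w) : Prop :=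
  ∀ t, 0 ≤ t → HasDerivWithinAt z (KOp α β L w (u t) (z t)) (Set.Ici 0) t

/-! ### The ordered exponential -/

/-- The `n`-th term `∫_{s ≤ r₁ ≤ ⋯ ≤ rₙ ≤ t} A(rₙ) ⋯ A(r₁) dr₁ ⋯ drₙ` of the ordered exponential
series of `A`. -/
def orderedTerm {E : Type*} [NormedAddCommGroup E] [NormedSpace ℝ E] (A : ℝ → E →L[ℝ] E) (s : ℝ) :
    ℕ → ℝ → E →L[ℝ] E
  | 0, _ => ContinuousLinearMap.id ℝ E
  | n + 1, t => ∫ r in s..t, (A r).comp (orderedTerm A s n r)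

/-- The (time-)ordered exponential of `∫_s^t A(r) dr`. -/
def orderedExp {E : Type*} [NormedAddCommGroup E] [NormedSpace ℝ E] (A : ℝ → E →L[ℝ] E)
    (s t : ℝ) : E →L[ℝ] E :=
  ∑' n : ℕ, orderedTerm A s n t

/-- The ordered exponential of `∫_s^t K(u_r) dr` on `L₂(w)`. -/
def evolution (α β : ℝ) (L : ℕ) (w : Weight) (u : ℝ → ℕ → ℝ) (s t : ℝ) : L2 w →L[ℝ] L2 w :=
  orderedExp (fun r => KOp α β L w (u r)) s t

/-! ### The driving martingale and the Ornstein-Uhlenbeck equation -/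

/-- `⟨M(k)⟩_t = ∫_0^t (F₊(u_s)(k) + F₋(u_s)(k)) ds`. -/
def bracket (α β : ℝ) (L : ℕ) (u : ℝ → ℕ → ℝ) (k : ℕ) (t : ℝ) : ℝ :=
  ∫ s in (0 : ℝ)..t, (Fplus α L (u s) k + Fminus β (u s) k)

/-- `M = (M(k))_k` is a family of independent real continuous centered Gaussian martingales,
null at time `0`, with Doob-Meyer brackets `bracket α β L u k`. Here `M t ω k` is the `k`-th
coordinate at time `t ≥ 0` (values at negative times are irrelevant). -/
structure IsDrivingMartingale (α β : ℝ) (L : ℕ) (u : ℝ → ℕ → ℝ) {Ω : Type*}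
    {mΩ : MeasurableSpace Ω} (P : Measure Ω) (ℱ : Filtration ℝ≥0 mΩ) (M : ℝ → Ω → ℕ → ℝ) :
    Prop where
  init : ∀ k, ∀ᵐ ω ∂P, M 0 ω k = 0
  continuous : ∀ k, ∀ᵐ ω ∂P, ContinuousOn (fun t : ℝ => M t ω k) (Set.Ici 0)
  martingale : ∀ k, Martingale (fun (t : ℝ≥0) ω => M t ω k) ℱ P
  compensated : ∀ k, Martingale (fun (t : ℝ≥0) ω => M t ω k ^ 2 - bracket α β L u k t) ℱ P
  gaussian : ∀ k, IsGaussianProcess (fun (t : ℝ≥0) ω => M t ω k) P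
  centered : ∀ k (t : ℝ≥0), ∫ ω, M t ω k ∂P = 0
  independent : iIndepFun (fun k ω (t : ℝ≥0) => M t ω k) P

/-- `Z` is a process in `L₂(w)` with initial value `Z₀` solving
`Z_t = Z₀ + ∫_0^t K(u_s) Z_s ds + M_t`, `t ≥ 0`; the integral is a Bochner integral in `L₂(w)`, and
the equation is read coordinatewise because `M_t` is only given as a sequence. -/
structure IsOUSolution (α β : ℝ) (L : ℕ) (w : Weight) (u : ℝ → ℕ → ℝ) {Ω : Type*}
    {mΩ : MeasurableSpace Ω} (P : Measure Ω) (M : ℝ → Ω → ℕ → ℝ) (Z₀ : Ω → L2 w)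
    (Z : ℝ → Ω → L2 w) : Prop where
  measurable : ∀ t, 0 ≤ t → AEStronglyMeasurable (Z t) P
  init : ∀ᵐ ω ∂P, Z 0 ω = Z₀ ω
  integrable : ∀ᵐ ω ∂P, ∀ t, 0 ≤ t →
    IntervalIntegrable (fun s => KOp α β L w (u s) (Z s ω)) volume 0 t
  equation : ∀ᵐ ω ∂P, ∀ t, 0 ≤ t →
    (Z t ω).seq = (Z₀ ω).seq + (∫ s in (0 : ℝ)..t, KOp α β L w (u s) (Z s ω)).seq + M t ω

/-- The `σ`-field generated by `Z₀` and `(M_s)_{0 ≤ s ≤ t}`. -/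
@[reducible] def sigmaInput {Ω : Type*} (M : ℝ → Ω → ℕ → ℝ) (Z₀ : Ω → L2 w) (t : ℝ) : MeasurableSpace Ω :=
  MeasurableSpace.comap Z₀ (borel (L2 w)) ⊔
    ⨆ s ∈ Set.Icc (0 : ℝ) t, MeasurableSpace.comap (M s) MeasurableSpace.pi

/-- A strong solution: `Z_t` is, up to null sets, a function of `Z₀` and `(M_s)_{0 ≤ s ≤ t}`. -/
structure IsStrongOUSolution (α β : ℝ) (L : ℕ) (w : Weight) (u : ℝ → ℕ → ℝ) {Ω : Type*}
    {mΩ : MeasurableSpace Ω} (P : Measure Ω) (M : ℝ → Ω → ℕ → ℝ) (Z₀ : Ω → L2 w)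
    (Z : ℝ → Ω → L2 w) : Prop extends IsOUSolution α β L w u P M Z₀ Z where
  adapted : ∀ t, 0 ≤ t → AEStronglyMeasurable[sigmaInput M Z₀ t] (Z t) P

/-- `I = ∫_0^t f(s) dN_s` for an operator-norm continuous deterministic integrand `f`: `I` is the
limit in probability of the sums `∑ f(t_i) (N_{t_{i+1}} - N_{t_i})` along every sequence of
partitions `0 = t_0 ≤ ⋯ ≤ t_m = t` of mesh tending to `0`. -/
def HasStochasticIntegral {E Ω : Type*} [NormedAddCommGroup E] [NormedSpace ℝ E]
    {mΩ : MeasurableSpace Ω} (P : Measure Ω) (f : ℝ → E →L[ℝ] E) (N : ℝ → Ω → E) (t : ℝ)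
    (I : Ω → E) : Prop :=
  ∀ (m : ℕ → ℕ) (p : ℕ → ℕ → ℝ),
    (∀ n, Monotone (p n) ∧ p n 0 = 0 ∧ p n (m n) = t) →
    (∀ δ > 0, ∀ᶠ n in atTop, ∀ i < m n, p n (i + 1) - p n i < δ) →
    TendstoInMeasure P
      (fun n ω => ∑ i ∈ Finset.range (m n), f (p n i) (N (p n (i + 1)) ω - N (p n i) ω)) atTop I

end SupermarketOU

end

open MeasureTheory ProbabilityTheory SupermarketOU

namespace SupermarketOU

/-! ### Ordered exponentials of bounded continuous operator families -/

section OrderedExp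

variable {E : Type*} [NormedAddCommGroup E] [NormedSpace ℝ E]

/-! Everything linear rests on one fact: `r ↦ K(u_r)` is a bounded, norm-continuous family of
operators on `L₂(w)`. The matrix `K(v)` is tridiagonal with bounded entries, and comparability of
neighbouring weights turns this into an operator bound (`exists_tridiagonal_bound`). `K(v)` is
Lipschitz in `v` for the sup distance, and `u` is Lipschitz in time uniformly over coordinates. The
ordered exponential `U(s,t)` is then a two-parameter propagator, differentiable in both times. This
gives the linearized flow, and Grönwall gives its uniqueness. In the difference of two solutions of
(OU) the noise cancels, so pathwise uniqueness is uniqueness for a linear Volterra equation.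

Probability enters existence mainly through one statement: almost surely `M` is a continuous path in
`L₂(w)`, and its squared norm has integrable supremum on `[0,T]`. Doob's inequality bounds the mean
of `sup M(k)²` by four times the bracket. The brackets, weighted by `1/w(k)`, are summable because
Grönwall propagates the `ℓ₁(w)` bound from `u_0` to `u_t`.

Since `U(s,t)` is deterministic and differentiable in `s`, integration by parts defines the
stochastic integral path by path as `M_t + ∫ U(s,t) K(u_s) M_s ds`. Riemann sums converge to it
almost surely (`tendsto_pathIntegral`), which yields both the integral representation and
adaptedness. Variation of constants gives the equation (`pathSolution_spec`), and a pathwise bound,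
linear in the norms of the data, gives the moments. -/

theorem orderedTerm_congr {A B : ℝ → E →L[ℝ] E} {s t : ℝ}
    (h : ∀ r ∈ Set.uIcc s t, A r = B r) (n : ℕ) :
    ∀ r ∈ Set.uIcc s t, orderedTerm A s n r = orderedTerm B s n r := by
  induction n with
  | zero => intro r _; rfl
  | succ n ih =>
    intro r hr
    refine intervalIntegral.integral_congr fun q hq => ?_
    have hq' : q ∈ Set.uIcc s t := Set.uIcc_subset_uIcc_left hr hq
    simp only [h q hq', ih q hq']

/-- Allows `K(u_r)`, controlled only for `r ≥ 0`, to be replaced by a family bounded and continuous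
on all of `ℝ`; see `evolution_eq`. -/
theorem orderedExp_congr {A B : ℝ → E →L[ℝ] E} {s t : ℝ}
    (h : ∀ r ∈ Set.uIcc s t, A r = B r) : orderedExp A s t = orderedExp B s t :=
  tsum_congr fun n => orderedTerm_congr h n t Set.right_mem_uIcc

variable {A : ℝ → E →L[ℝ] E} {C : ℝ}

theorem continuous_orderedTerm (hA : Continuous A) (s : ℝ) (n : ℕ) :
    Continuous (orderedTerm A s n) := by
  induction n with
  | zero => exact continuous_const
  | succ n ih =>
    exact intervalIntegral.continuous_primitive
      (fun a b => (hA.clm_comp ih).intervalIntegrable a b) s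

theorem hasDerivAt_orderedTerm_succ [CompleteSpace E] (hA : Continuous A) (s : ℝ) (n : ℕ) (t : ℝ) :
    HasDerivAt (orderedTerm A s (n + 1)) (A t * orderedTerm A s n t) t := by
  have hc := hA.clm_comp (continuous_orderedTerm hA s n)
  exact intervalIntegral.integral_hasDerivAt_right (hc.intervalIntegrable s t)
    (hc.stronglyMeasurableAtFilter _ _) hc.continuousAt

/-- The factorial is the volume of the ordered simplex, gained one integration at a time. The
absolute value covers `t < s`, needed since propagators also run backwards. -/
theorem norm_orderedTerm_le (hC : 0 ≤ C) (hAC : ∀ r, ‖A r‖ ≤ C) (s : ℝ) (n : ℕ)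
    (t : ℝ) : ‖orderedTerm A s n t‖ ≤ (C * |t - s|) ^ n / n.factorial := by
  induction n generalizing t with
  | zero => simpa [orderedTerm] using ContinuousLinearMap.norm_id_le (𝕜 := ℝ) (E := E)
  | succ n ih =>
    have h1 : ‖orderedTerm A s (n + 1) t‖ ≤
        ∫ r in Set.uIoc s t, C ^ (n + 1) / n.factorial * |r - s| ^ n := by
      refine intervalIntegral.norm_integral_le_integral_norm_uIoc.trans ?_
      refine integral_mono_of_nonneg (ae_of_all _ fun r => norm_nonneg _) ?_
        (ae_of_all _ fun r => ?_)
      · have : Continuous fun r : ℝ => C ^ (n + 1) / n.factorial * |r - s| ^ n := by fun_prop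
        exact (this.intervalIntegrable s t).def'
      · calc ‖(A r).comp (orderedTerm A s n r)‖ ≤ ‖A r‖ * ‖orderedTerm A s n r‖ :=
              ContinuousLinearMap.opNorm_comp_le _ _
          _ ≤ C * ((C * |r - s|) ^ n / n.factorial) :=
              mul_le_mul (hAC r) (ih r) (norm_nonneg _) hC
          _ = C ^ (n + 1) / n.factorial * |r - s| ^ n := by rw [mul_pow]; ring
    refine h1.trans (le_of_eq ?_)
    rw [integral_const_mul, integral_pow_abs_sub_uIoc, Nat.factorial_succ, mul_pow]
    have : (n.factorial : ℝ) ≠ 0 := by positivity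
    push_cast
    field_simp

theorem orderedTerm_self (s : ℝ) (n : ℕ) : orderedTerm A s (n + 1) s = 0 :=
  intervalIntegral.integral_same

theorem orderedExp_self (s : ℝ) : orderedExp A s s = 1 := by
  rw [orderedExp, tsum_eq_single 0]
  · rfl
  · intro n hn
    obtain ⟨m, rfl⟩ := Nat.exists_eq_succ_of_ne_zero hn
    exact orderedTerm_self s m

theorem summable_orderedTerm [CompleteSpace E] (hC : 0 ≤ C) (hAC : ∀ r, ‖A r‖ ≤ C) (s t : ℝ) :
    Summable fun n => orderedTerm A s n t :=
  Summable.of_norm_bounded (Real.summable_pow_div_factorial (C * |t - s|))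
    fun n => norm_orderedTerm_le hC hAC s n t

theorem norm_orderedExp_le (hC : 0 ≤ C) (hAC : ∀ r, ‖A r‖ ≤ C) (s t : ℝ) :
    ‖orderedExp A s t‖ ≤ Real.exp (C * |t - s|) := by
  rw [Real.exp_eq_exp_ℝ, NormedSpace.exp_eq_tsum_div]
  exact tsum_of_norm_bounded (Real.summable_pow_div_factorial (C * |t - s|)).hasSum
    fun n => norm_orderedTerm_le hC hAC s n t

variable [CompleteSpace E]

theorem hasDerivAt_orderedExp (hA : Continuous A) (hC : 0 ≤ C) (hAC : ∀ r, ‖A r‖ ≤ C)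
    (s t : ℝ) : HasDerivAt (orderedExp A s) (A t * orderedExp A s t) t := by
  set R : ℝ := |t - s| + 1
  -- Term `n + 1` differentiates to `A` times term `n`, and the constant term to zero; hence the
  -- shifted index in `u` and `g'`. The bound is uniform on the ball of radius `R`, which contains
  -- `t`.
  let u : ℕ → ℝ := fun n => Nat.casesOn n 0 fun n => C * ((C * R) ^ n / n.factorial)
  let g' : ℕ → ℝ → E →L[ℝ] E := fun n r => Nat.casesOn n 0 fun n => A r * orderedTerm A s n r
  have hu : Summable u := by
    rw [← summable_nat_add_iff 1]
    exact (Real.summable_pow_div_factorial (C * R)).mul_left C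
  have ht : t ∈ Metric.ball s R := by
    rw [Metric.mem_ball, Real.dist_eq]; simp [R]
  have key := hasDerivAt_tsum_of_isPreconnected (g := orderedTerm A s) (g' := g') hu
    Metric.isOpen_ball (convex_ball s R).isPreconnected (fun n y _ => ?_) (fun n y hy => ?_)
    (Metric.mem_ball_self (by positivity)) (summable_orderedTerm hC hAC s s) ht
  · have h2 : ∑' n, g' n t = A t * orderedExp A s t := by
      have hs : Summable fun n => g' n t := by
        rw [← summable_nat_add_iff 1]
        exact (summable_orderedTerm hC hAC s t).mul_left (A t)
      rw [hs.tsum_eq_zero_add]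
      refine (zero_add _).trans ?_
      exact (summable_orderedTerm hC hAC s t).tsum_mul_left (A t)
    rw [h2] at key
    exact key
  · cases n with
    | zero => exact hasDerivAt_const y _
    | succ n => exact hasDerivAt_orderedTerm_succ hA s n y
  · cases n with
    | zero => simp [g', u]
    | succ n =>
      refine (norm_mul_le _ _).trans (mul_le_mul (hAC y) ?_ (norm_nonneg _) hC)
      refine (norm_orderedTerm_le hC hAC s n y).trans ?_
      have : |y - s| ≤ R := by
        rw [Metric.mem_ball, Real.dist_eq] at hy; exact hy.le
      gcongr

/-- As functions of `t` both sides solve `X' = A X` and agree at `t = r`. No order of the times is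
assumed, so `U(s,t)` is invertible with inverse `U(t,s)`. -/
theorem orderedExp_mul (hA : Continuous A) (hC : 0 ≤ C) (hAC : ∀ r, ‖A r‖ ≤ C) (s r t : ℝ) :
    orderedExp A r t * orderedExp A s r = orderedExp A s t := by
  have := ODE_solution_unique_univ (v := fun q (X : E →L[ℝ] E) => A q * X)
    (s := fun _ => Set.univ) (K := C.toNNReal) (t₀ := r)
    (f := fun q => orderedExp A r q * orderedExp A s r) (g := orderedExp A s)
    (fun q => ?_) (fun q => ⟨?_, trivial⟩)
    (fun q => ⟨hasDerivAt_orderedExp hA hC hAC s q, trivial⟩) ?_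
  · exact congrFun this t
  · refine (LipschitzWith.of_dist_le_mul fun X Y => ?_).lipschitzOnWith
    rw [dist_eq_norm, dist_eq_norm, ← mul_sub, Real.coe_toNNReal C hC]
    exact (norm_mul_le _ _).trans (mul_le_mul_of_nonneg_right (hAC q) (norm_nonneg _))
  · have := (hasDerivAt_orderedExp hA hC hAC r q).mul_const (orderedExp A s r)
    simpa only [mul_assoc] using this
  · simp only [orderedExp_self, one_mul]

/-- The lower limit occurs in every nested integral, so the series is not differentiated directly:
`U(s,t)` is the inverse of `U(t,s)`, and inversion has derivative `H ↦ -X⁻¹ H X⁻¹`. -/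
theorem hasDerivAt_orderedExp_left (hA : Continuous A) (hC : 0 ≤ C) (hAC : ∀ r, ‖A r‖ ≤ C)
    (s t : ℝ) : HasDerivAt (fun r => orderedExp A r t) (-(orderedExp A s t * A s)) s := by
  let V : ℝ → (E →L[ℝ] E)ˣ := fun r => ⟨orderedExp A t r, orderedExp A r t,
    by rw [orderedExp_mul hA hC hAC, orderedExp_self],
    by rw [orderedExp_mul hA hC hAC, orderedExp_self]⟩
  have h1 : (fun r => orderedExp A r t) = fun r => Ring.inverse (orderedExp A t r) := by
    funext r
    exact (Ring.inverse_unit (V r)).symm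
  rw [h1]
  have h2 := (hasFDerivAt_ringInverse (𝕜 := ℝ) (V s)).comp_hasDerivAt s
    (hasDerivAt_orderedExp hA hC hAC t s)
  refine h2.congr_deriv ?_
  change -(orderedExp A s t * (A s * orderedExp A t s) * orderedExp A s t) = _
  rw [mul_assoc, mul_assoc, orderedExp_mul hA hC hAC, orderedExp_self, mul_one]

theorem continuous_orderedExp_left (hA : Continuous A) (hC : 0 ≤ C) (hAC : ∀ r, ‖A r‖ ≤ C)
    (t : ℝ) : Continuous fun r => orderedExp A r t :=
  continuous_iff_continuousAt.2 fun s => (hasDerivAt_orderedExp_left hA hC hAC s t).continuousAt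

/-- Variation of constants. -/
theorem hasDerivAt_duhamel (hA : Continuous A) (hC : 0 ≤ C) (hAC : ∀ r, ‖A r‖ ≤ C)
    {f : ℝ → E} (hf : Continuous f) (y : E) (t : ℝ) :
    HasDerivAt (fun t => orderedExp A 0 t y + ∫ s in (0 : ℝ)..t, orderedExp A s t (f s))
      (A t (orderedExp A 0 t y + ∫ s in (0 : ℝ)..t, orderedExp A s t (f s)) + f t) t := by
  have hW : Continuous fun s => orderedExp A s 0 (f s) :=
    (continuous_orderedExp_left hA hC hAC 0).clm_apply hf
  -- Factoring `U(s,t) = U(0,t) U(s,0)` removes `t` from the integrand, leaving a product to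
  -- differentiate.
  have hrw : ∀ t, ∫ s in (0 : ℝ)..t, orderedExp A s t (f s) =
      orderedExp A 0 t (∫ s in (0 : ℝ)..t, orderedExp A s 0 (f s)) := by
    intro t
    rw [← ContinuousLinearMap.intervalIntegral_comp_comm _ (hW.intervalIntegrable 0 t)]
    refine intervalIntegral.integral_congr fun s _ => ?_
    simp only [← orderedExp_mul hA hC hAC s 0 t]
    rfl
  simp only [hrw, ← map_add]
  have h1 : HasDerivAt (fun t => y + ∫ s in (0 : ℝ)..t, orderedExp A s 0 (f s))
      (orderedExp A t 0 (f t)) t :=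
    (intervalIntegral.integral_hasDerivAt_right (hW.intervalIntegrable 0 t)
      (hW.stronglyMeasurableAtFilter _ _) hW.continuousAt).const_add y
  refine ((hasDerivAt_orderedExp hA hC hAC 0 t).clm_apply h1).congr_deriv ?_
  have h2 : orderedExp A 0 t (orderedExp A t 0 (f t)) = f t := by
    change (orderedExp A 0 t * orderedExp A t 0) (f t) = f t
    rw [orderedExp_mul hA hC hAC, orderedExp_self]
    rfl
  rw [h2]
  rfl

end OrderedExp

/-! ### Commuting families: the ordered exponential is the ordinary one. -/

section Commuting

variable {R : Type*} [NormedRing R] [NormedAlgebra ℝ R]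

theorem hasDerivAt_pow_of_commute {B : ℝ → R} {B' : R} {t : ℝ} (hB : HasDerivAt B B' t)
    (hc : Commute B' (B t)) (n : ℕ) :
    HasDerivAt (fun r => B r ^ (n + 1)) ((n + 1 : ℝ) • (B' * B t ^ n)) t := by
  induction n with
  | zero => simpa using hB
  | succ n ih =>
    have h := ih.fun_mul hB
    simp only [← pow_succ (B _)] at h
    refine HasDerivAt.congr_deriv (f := fun r => B r ^ (n + 1 + 1)) h ?_
    have h1 : B t ^ (n + 1) * B' = B' * B t ^ (n + 1) := ((hc.pow_right (n + 1)).eq).symm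
    rw [h1, smul_mul_assoc, mul_assoc, ← pow_succ]
    push_cast
    rw [add_smul ((n : ℝ) + 1), one_smul]

theorem commute_intervalIntegral [CompleteSpace R] {A : ℝ → R} (hA : Continuous A) {s t : ℝ} {a : R}
    (h : ∀ r ∈ Set.uIcc s t, Commute a (A r)) : Commute a (∫ r in s..t, A r) := by
  have h1 := (ContinuousLinearMap.mul ℝ R a).intervalIntegral_comp_comm
    (hA.intervalIntegrable (μ := volume) s t)
  have h2 := ((ContinuousLinearMap.mul ℝ R).flip a).intervalIntegral_comp_comm
    (hA.intervalIntegrable (μ := volume) s t)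
  simp only [ContinuousLinearMap.flip_apply, ContinuousLinearMap.mul_apply'] at h1 h2
  rw [Commute, SemiconjBy, ← h1, ← h2]
  exact intervalIntegral.integral_congr fun r hr => (h r hr).eq

variable {E : Type*} [NormedAddCommGroup E] [NormedSpace ℝ E] [CompleteSpace E]

/-- With `B = ∫ A`, each `A(q)` commutes with `B(q)`, so `A Bⁿ` is the derivative of `Bⁿ⁺¹/(n+1)`
and the iterated integral is evaluated exactly. -/
theorem orderedTerm_of_commute {A : ℝ → E →L[ℝ] E} (hA : Continuous A) {s t : ℝ}
    (h : ∀ r ∈ Set.uIcc s t, ∀ r' ∈ Set.uIcc s t, Commute (A r) (A r')) (n : ℕ) :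
    ∀ r ∈ Set.uIcc s t,
      orderedTerm A s n r = (n.factorial : ℝ)⁻¹ • (∫ q in s..r, A q) ^ n := by
  induction n with
  | zero => intro r _; simp [orderedTerm, ContinuousLinearMap.one_def]
  | succ n ih =>
    intro r hr
    have hsub : Set.uIcc s r ⊆ Set.uIcc s t := Set.uIcc_subset_uIcc_left hr
    have hB : ∀ q, HasDerivAt (fun q => ∫ p in s..q, A p) (A q) q := fun q =>
      intervalIntegral.integral_hasDerivAt_right (hA.intervalIntegrable s q)
        (hA.stronglyMeasurableAtFilter _ _) hA.continuousAt
    have hBc : Continuous fun q => ∫ p in s..q, A p :=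
      continuous_iff_continuousAt.2 fun q => (hB q).continuousAt
    have h1 : orderedTerm A s (n + 1) r =
        ∫ q in s..r, A q * ((n.factorial : ℝ)⁻¹ • (∫ p in s..q, A p) ^ n) :=
      intervalIntegral.integral_congr fun q hq => by
        simp only [ih q (hsub hq)]; rfl
    rw [h1, intervalIntegral.integral_eq_sub_of_hasDerivAt
      (f := fun q => ((n + 1).factorial : ℝ)⁻¹ • (∫ p in s..q, A p) ^ (n + 1))]
    · simp
    · intro q hq
      refine ((hasDerivAt_pow_of_commute (hB q) ?_ n).fun_const_smul _).congr_deriv ?_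
      · exact commute_intervalIntegral hA fun p hp => h q (hsub hq) p
          (Set.uIcc_subset_uIcc_left (hsub hq) hp)
      · rw [smul_smul, mul_smul_comm, Nat.factorial_succ]
        congr 1
        have : (n.factorial : ℝ) ≠ 0 := by positivity
        push_cast
        field_simp
    · exact (hA.fun_mul ((hBc.fun_pow n).fun_const_smul _)).intervalIntegrable s r

theorem orderedExp_of_commute {A : ℝ → E →L[ℝ] E} (hA : Continuous A) {s t : ℝ}
    (h : ∀ r ∈ Set.uIcc s t, ∀ r' ∈ Set.uIcc s t, Commute (A r) (A r')) :
    orderedExp A s t = NormedSpace.exp (∫ q in s..t, A q) := by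
  rw [NormedSpace.exp_eq_tsum ℝ]
  exact tsum_congr fun n => orderedTerm_of_commute hA h n t Set.right_mem_uIcc

end Commuting

/-! ### Riemann sums against a continuous path -/

section Riemann

variable {E : Type*} [NormedAddCommGroup E] [NormedSpace ℝ E]

/-- Abel summation: the increments move from the path `N`, which will be merely continuous, to the
differentiable integrand `G`. -/
theorem sum_apply_sub_eq (G : ℝ → E →L[ℝ] E) (N : ℝ → E) (p : ℕ → ℝ) (m : ℕ) :
    ∑ i ∈ Finset.range m, G (p i) (N (p (i + 1)) - N (p i)) =
      G (p m) (N (p m)) - G (p 0) (N (p 0)) -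
        ∑ i ∈ Finset.range m, (G (p (i + 1)) - G (p i)) (N (p (i + 1))) := by
  induction m with
  | zero => simp
  | succ m ih =>
    rw [Finset.sum_range_succ, Finset.sum_range_succ, ih]
    simp only [map_sub, sub_apply]
    abel

variable [CompleteSpace E]

/-- After Abel summation each term is `∫ G'(s) N(p_{i+1}) ds` over its cell. Uniform continuity of
`N` on `[0,t]` lets `N(p_{i+1})` be replaced by `N(s)`. -/
theorem tendsto_riemannSum {G G' : ℝ → E →L[ℝ] E} (hG : ∀ s, HasDerivAt G (G' s) s)
    (hG' : Continuous G') {N : ℝ → E} (hN : Continuous N) {t : ℝ} {m : ℕ → ℕ}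
    {p : ℕ → ℕ → ℝ} (hp : ∀ n, Monotone (p n) ∧ p n 0 = 0 ∧ p n (m n) = t)
    (hmesh : ∀ δ > 0, ∀ᶠ n in atTop, ∀ i < m n, p n (i + 1) - p n i < δ) :
    Tendsto (fun n => ∑ i ∈ Finset.range (m n), G (p n i) (N (p n (i + 1)) - N (p n i))) atTop
      (𝓝 (G t (N t) - G 0 (N 0) - ∫ s in (0 : ℝ)..t, G' s (N s))) := by
  simp only [sum_apply_sub_eq]
  simp only [fun n => (hp n).2.1, fun n => (hp n).2.2]
  refine tendsto_const_nhds.sub ?_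
  have ht : 0 ≤ t := by
    rw [← (hp 0).2.1, ← (hp 0).2.2]; exact (hp 0).1 (Nat.zero_le _)
  obtain ⟨B, hB⟩ := (isCompact_Icc (a := (0 : ℝ)) (b := t)).exists_bound_of_continuousOn
    hG'.continuousOn
  have hB0 : 0 ≤ B := (norm_nonneg _).trans (hB 0 ⟨le_rfl, ht⟩)
  rw [Metric.tendsto_atTop']
  intro ε hε
  have huc := (isCompact_Icc (a := (0 : ℝ)) (b := t)).uniformContinuousOn_of_continuous
    hN.continuousOn
  rw [Metric.uniformContinuousOn_iff] at huc
  -- The total error is at most `B η t`, which this choice keeps at or below `ε / 2`; the `+ 1`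
  -- avoids division by zero.
  set η : ℝ := ε / (2 * (B * t + 1))
  have hη : 0 < η := by positivity
  obtain ⟨δ, hδ, hNδ⟩ := huc η hη
  obtain ⟨n₀, hn₀⟩ := eventually_atTop.1 (hmesh δ hδ)
  refine ⟨n₀, fun n hn => ?_⟩
  obtain ⟨hmono, h0, ht'⟩ := hp n
  have hint : ∀ a b : ℝ, IntervalIntegrable (fun s => G' s (N s)) volume a b := fun a b =>
    (hG'.clm_apply hN).intervalIntegrable a b
  have hsplit : ∫ s in (0 : ℝ)..t, G' s (N s) =
      ∑ i ∈ Finset.range (m n), ∫ s in (p n i)..(p n (i + 1)), G' s (N s) := by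
    rw [intervalIntegral.sum_integral_adjacent_intervals fun i _ => hint _ _, h0, ht']
  have hterm : ∀ i, (G (p n (i + 1)) - G (p n i)) (N (p n (i + 1))) =
      ∫ s in (p n i)..(p n (i + 1)), G' s (N (p n (i + 1))) := by
    intro i
    rw [intervalIntegral.integral_eq_sub_of_hasDerivAt
      (f := fun s => G s (N (p n (i + 1))))]
    · rfl
    · intro s _
      simpa using (hG s).clm_apply (hasDerivAt_const s (N (p n (i + 1))))
    · exact (hG'.clm_apply continuous_const).intervalIntegrable _ _
  rw [dist_eq_norm, hsplit, ← Finset.sum_sub_distrib]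
  have hbound : ∀ i ∈ Finset.range (m n),
      ‖(G (p n (i + 1)) - G (p n i)) (N (p n (i + 1))) -
        ∫ s in (p n i)..(p n (i + 1)), G' s (N s)‖ ≤ B * η * (p n (i + 1) - p n i) := by
    intro i hi
    rw [Finset.mem_range] at hi
    have hle : p n i ≤ p n (i + 1) := hmono (Nat.le_succ i)
    have hlo : 0 ≤ p n i := h0 ▸ hmono (Nat.zero_le i)
    have hhi : p n (i + 1) ≤ t := ht' ▸ hmono hi
    rw [hterm, ← intervalIntegral.integral_sub
      ((hG'.clm_apply continuous_const).intervalIntegrable _ _) (hint _ _)]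
    have := intervalIntegral.norm_integral_le_of_norm_le_const
      (f := fun s => G' s (N (p n (i + 1))) - G' s (N s)) (a := p n i) (b := p n (i + 1))
      (C := B * η) fun s hs => ?_
    · rwa [abs_of_nonneg (sub_nonneg.2 hle)] at this
    · rw [Set.uIoc_of_le hle] at hs
      have hst : s ∈ Set.Icc 0 t := ⟨hlo.trans hs.1.le, hs.2.trans hhi⟩
      rw [← map_sub]
      refine ((G' s).le_opNorm _).trans (mul_le_mul (hB s hst) ?_ (norm_nonneg _) hB0)
      rw [← dist_eq_norm]
      refine (hNδ _ ⟨hlo.trans hle, hhi⟩ _ hst ?_).le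
      rw [Real.dist_eq, abs_of_nonneg (sub_nonneg.2 hs.2)]
      linarith [hn₀ n hn.le i hi, hs.1]
  refine (norm_sum_le_of_le _ hbound).trans_lt ?_
  rw [← Finset.mul_sum, Finset.sum_range_sub (p n), h0, ht', sub_zero]
  have : B * η * t = ε / 2 * (B * t / (B * t + 1)) := by
    simp only [η]; field_simp
  rw [this]
  have h1 : B * t / (B * t + 1) ≤ 1 := by
    rw [div_le_one (by positivity)]; linarith
  nlinarith

end Riemann

end SupermarketOU

namespace SupermarketOU

variable {w : Weight}

/-! ### The operators `K(v)` -/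

theorem tails_anti {v : ℕ → ℝ} (hv : v ∈ tails) : Antitone v := antitone_nat_of_succ_le hv.2.1

theorem tails_nonneg {v : ℕ → ℝ} (hv : v ∈ tails) (k : ℕ) : 0 ≤ v k :=
  (tails_anti hv).le_of_tendsto hv.2.2 k

theorem tails_le_one {v : ℕ → ℝ} (hv : v ∈ tails) (k : ℕ) : v k ≤ 1 :=
  hv.1 ▸ tails_anti hv (Nat.zero_le k)

theorem tails_pow_nonneg {v : ℕ → ℝ} (hv : v ∈ tails) (k n : ℕ) : 0 ≤ v k ^ n :=
  pow_nonneg (tails_nonneg hv k) n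

theorem tails_pow_le_one {v : ℕ → ℝ} (hv : v ∈ tails) (k n : ℕ) : v k ^ n ≤ 1 :=
  pow_le_one₀ (tails_nonneg hv k) (tails_le_one hv k)

/-- In the constant, `3` comes from squaring a sum of three terms, and `d` and `c⁻¹` from moving the
weight to the left and to the right neighbour. As `y` is only a sequence, membership in `L₂(w)` is
obtained together with the norm bound. -/
theorem exists_tridiagonal_bound (hw : w.Comparable) :
    ∃ κ : ℝ, 0 ≤ κ ∧ ∀ (x : L2 w) (y : ℕ → ℝ) (m : ℝ),
      (∀ k, |y (k + 1)| ≤ m * (|x.seq k| + |x.seq (k + 1)| + |x.seq (k + 2)|)) →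
      SqSummable w y ∧ ∑' k : ℕ, y (k + 1) ^ 2 / w (k + 1) ≤ (κ * m * ‖x‖) ^ 2 := by
  obtain ⟨c, d, hc, hd, hcd⟩ := hw
  refine ⟨Real.sqrt (3 * (d + 1 + c⁻¹)), Real.sqrt_nonneg _, fun x y m hy => ?_⟩
  let S : ℕ → ℝ := fun k => x.seq (k + 1) ^ 2 / w (k + 1)
  -- Contribution of the left neighbours; its first entry is `0` because `x(0) = 0`, so it has the
  -- same sum as `S`.
  let S' : ℕ → ℝ := fun k => Nat.casesOn k 0 S
  have hS : HasSum S (‖x‖ ^ 2) := by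
    rw [L2.norm_sq]; exact x.sqSummable.hasSum
  have hS0 : ∀ k, 0 ≤ S k := fun k => div_nonneg (sq_nonneg _) (w.pos k).le
  have hS' : HasSum S' (‖x‖ ^ 2) := by
    rw [← hasSum_nat_add_iff' 1]
    simpa [S'] using hS
  have hS1 : Summable fun k => S (k + 1) := (summable_nat_add_iff 1).2 hS.summable
  have hS1le : ∑' k, S (k + 1) ≤ ‖x‖ ^ 2 := by
    rw [← hS.tsum_eq, hS.summable.tsum_eq_zero_add]
    linarith [hS0 0]
  have hG : Summable fun k => 3 * m ^ 2 * (d * S' k + S k + c⁻¹ * S (k + 1)) :=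
    (((hS'.summable.mul_left d).add hS.summable).add (hS1.mul_left c⁻¹)).mul_left _
  have hle : ∀ k, y (k + 1) ^ 2 / w (k + 1) ≤
      3 * m ^ 2 * (d * S' k + S k + c⁻¹ * S (k + 1)) := by
    intro k
    have hwk := w.pos k
    have h1 : x.seq k ^ 2 / w (k + 1) ≤ d * S' k := by
      cases k with
      | zero => simp [S', x.seq_zero_idx]
      | succ k =>
        simp only [S', S]
        rw [← mul_div_assoc, div_le_div_iff₀ hwk (w.pos k)]
        nlinarith [(hcd (k + 1) (by omega)).2, sq_nonneg (x.seq (k + 1))]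
    have h2 : x.seq (k + 2) ^ 2 / w (k + 1) ≤ c⁻¹ * S (k + 1) := by
      simp only [S]
      rw [← div_eq_inv_mul, div_div, div_le_div_iff₀ hwk (mul_pos (w.pos (k + 1)) hc)]
      nlinarith [(hcd (k + 1) (by omega)).1, sq_nonneg (x.seq (k + 2))]
    have h3 : y (k + 1) ^ 2 ≤
        3 * m ^ 2 * (x.seq k ^ 2 + x.seq (k + 1) ^ 2 + x.seq (k + 2) ^ 2) := by
      have h4 := pow_le_pow_left₀ (abs_nonneg _) (hy k) 2
      rw [sq_abs, mul_pow] at h4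
      have h5 : (|x.seq k| + |x.seq (k + 1)| + |x.seq (k + 2)|) ^ 2 ≤
          3 * (x.seq k ^ 2 + x.seq (k + 1) ^ 2 + x.seq (k + 2) ^ 2) := by
        rw [← sq_abs (x.seq k), ← sq_abs (x.seq (k + 1)), ← sq_abs (x.seq (k + 2))]
        nlinarith [sq_nonneg (|x.seq k| - |x.seq (k + 1)|),
          sq_nonneg (|x.seq k| - |x.seq (k + 2)|), sq_nonneg (|x.seq (k + 1)| - |x.seq (k + 2)|)]
      calc y (k + 1) ^ 2 ≤ _ := h4
        _ ≤ _ := mul_le_mul_of_nonneg_left h5 (sq_nonneg m)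
        _ = _ := by ring
    calc y (k + 1) ^ 2 / w (k + 1) ≤
        3 * m ^ 2 * (x.seq k ^ 2 + x.seq (k + 1) ^ 2 + x.seq (k + 2) ^ 2) / w (k + 1) :=
          div_le_div_of_nonneg_right h3 hwk.le
      _ = 3 * m ^ 2 * (x.seq k ^ 2 / w (k + 1) + S k + x.seq (k + 2) ^ 2 / w (k + 1)) := by
          simp only [S]; ring
      _ ≤ _ := by gcongr
  have hy2 : SqSummable w y :=
    Summable.of_nonneg_of_le (fun k => div_nonneg (sq_nonneg _) (w.pos k).le) hle hG
  refine ⟨hy2, (hy2.tsum_le_tsum hle hG).trans ?_⟩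
  rw [tsum_mul_left, ((hS'.summable.mul_left d).add hS.summable).tsum_add (hS1.mul_left c⁻¹),
    (hS'.summable.mul_left d).tsum_add hS.summable, tsum_mul_left, tsum_mul_left, hS'.tsum_eq,
    hS.tsum_eq, mul_pow, mul_pow, Real.sq_sqrt (by positivity)]
  have : c⁻¹ * ∑' k, S (k + 1) ≤ c⁻¹ * ‖x‖ ^ 2 := by gcongr
  nlinarith [sq_nonneg m]

theorem norm_le_of_tridiagonal {κ : ℝ} (hκ0 : 0 ≤ κ) (hκ : ∀ (x : L2 w) (y : ℕ → ℝ) (m : ℝ),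
      (∀ k, |y (k + 1)| ≤ m * (|x.seq k| + |x.seq (k + 1)| + |x.seq (k + 2)|)) →
      SqSummable w y ∧ ∑' k : ℕ, y (k + 1) ^ 2 / w (k + 1) ≤ (κ * m * ‖x‖) ^ 2)
    {x y : L2 w} {m : ℝ} (hm : 0 ≤ m)
    (h : ∀ k, |y.seq (k + 1)| ≤ m * (|x.seq k| + |x.seq (k + 1)| + |x.seq (k + 2)|)) :
    ‖y‖ ≤ κ * m * ‖x‖ := by
  refine le_of_sq_le_sq ?_ (by positivity)
  rw [L2.norm_sq]
  exact (hκ x y.seq m h).2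

variable {α β : ℝ} {L : ℕ}

theorem abs_Kseq_le (hα : 0 < α) (hβ : 0 < β) {v : ℕ → ℝ} (hv : v ∈ tails) (x : ℕ → ℝ) (k : ℕ) :
    |Kseq α β L v x (k + 1)| ≤ (α * L + β) * (|x k| + |x (k + 1)| + |x (k + 2)|) := by
  have h0 := tails_pow_nonneg hv k (L - 1)
  have h1 := tails_pow_nonneg hv (k + 1) (L - 1)
  have h2 := tails_pow_le_one hv k (L - 1)
  have h3 := tails_pow_le_one hv (k + 1) (L - 1)
  have hL0 : 0 ≤ α * L := by positivity
  simp only [Kseq]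
  have e1 : |α * L * v k ^ (L - 1) * x k| ≤ (α * L + β) * |x k| := by
    rw [abs_mul, abs_of_nonneg (by positivity)]
    refine mul_le_mul_of_nonneg_right ?_ (abs_nonneg _)
    nlinarith
  have e2 : |(α * L * v (k + 1) ^ (L - 1) + β) * x (k + 1)| ≤ (α * L + β) * |x (k + 1)| := by
    rw [abs_mul, abs_of_nonneg (by positivity)]
    refine mul_le_mul_of_nonneg_right ?_ (abs_nonneg _)
    nlinarith
  have e3 : |β * x (k + 2)| ≤ (α * L + β) * |x (k + 2)| := by
    rw [abs_mul, abs_of_pos hβ]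
    refine mul_le_mul_of_nonneg_right ?_ (abs_nonneg _)
    linarith
  have e4 := abs_sub (α * L * v k ^ (L - 1) * x k) ((α * L * v (k + 1) ^ (L - 1) + β) * x (k + 1))
  refine (abs_add_le _ _).trans ?_
  linarith

theorem Kseq_add (v x y : ℕ → ℝ) : Kseq α β L v (x + y) = Kseq α β L v x + Kseq α β L v y := by
  funext k
  cases k with
  | zero => simp [Kseq]
  | succ k => simp only [Kseq, Pi.add_apply]; ring

theorem Kseq_smul (v x : ℕ → ℝ) (r : ℝ) : Kseq α β L v (r • x) = r • Kseq α β L v x := by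
  funext k
  cases k with
  | zero => simp [Kseq]
  | succ k => simp only [Kseq, Pi.smul_apply, smul_eq_mul]; ring

theorem exists_KOp_bound (hα : 0 < α) (hβ : 0 < β) (hw : w.Comparable) :
    ∃ C : ℝ, 0 ≤ C ∧ ∀ v ∈ tails,
      (∀ x : L2 w, (KOp α β L w v x).seq = Kseq α β L v x.seq) ∧ ‖KOp α β L w v‖ ≤ C := by
  obtain ⟨κ, hκ0, hκ⟩ := exists_tridiagonal_bound hw
  have hm : 0 ≤ α * L + β := by positivity
  refine ⟨κ * (α * L + β), by positivity, fun v hv => ?_⟩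
  have hseq : ∀ x : L2 w, (toL2 w (Kseq α β L v x.seq)).seq = Kseq α β L v x.seq := fun x =>
    toL2_seq rfl (hκ x _ _ (abs_Kseq_le hα hβ hv x.seq)).1
  let T : L2 w →ₗ[ℝ] L2 w :=
    { toFun := fun x => toL2 w (Kseq α β L v x.seq)
      map_add' := fun x y => L2.seq_injective (by
        rw [hseq, L2.seq_add, L2.seq_add, hseq, hseq, Kseq_add])
      map_smul' := fun r x => L2.seq_injective (by
        rw [hseq, L2.seq_smul, RingHom.id_apply, L2.seq_smul, hseq, Kseq_smul]) }
  -- `KOp` is defined by choice, so an explicit bounded operator must be exhibited before its action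
  -- on sequences is known.
  have hex : ∃ T : L2 w →L[ℝ] L2 w, ∀ x, (T x).seq = Kseq α β L v x.seq :=
    ⟨T.mkContinuous (κ * (α * L + β)) fun x => norm_le_of_tridiagonal hκ0 hκ hm fun k => by
      rw [show (T x).seq = _ from hseq x]
      exact abs_Kseq_le hα hβ hv x.seq k, hseq⟩
  have hK : ∀ x : L2 w, (KOp α β L w v x).seq = Kseq α β L v x.seq := by
    rw [KOp, dif_pos hex]; exact hex.choose_spec
  refine ⟨hK, ContinuousLinearMap.opNorm_le_bound _ (by positivity) fun x =>
    norm_le_of_tridiagonal hκ0 hκ hm fun k => ?_⟩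
  rw [hK]
  exact abs_Kseq_le hα hβ hv x.seq k

theorem abs_pow_sub_pow_le_of_tails {v v' : ℕ → ℝ} (hv : v ∈ tails) (hv' : v' ∈ tails) {δ : ℝ}
    (h : ∀ k, |v k - v' k| ≤ δ) (n k : ℕ) : |v k ^ n - v' k ^ n| ≤ n * δ := by
  refine (abs_pow_sub_pow_le _ _ n).trans ?_
  have h1 : max |v k| |v' k| ≤ 1 := max_le
    ((abs_of_nonneg (tails_nonneg hv k)).le.trans (tails_le_one hv k))
    ((abs_of_nonneg (tails_nonneg hv' k)).le.trans (tails_le_one hv' k))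
  have h2 : max |v k| |v' k| ^ (n - 1) ≤ 1 := pow_le_one₀ (le_max_of_le_left (abs_nonneg _)) h1
  calc |v k - v' k| * n * max |v k| |v' k| ^ (n - 1) ≤ |v k - v' k| * n * 1 := by gcongr
    _ ≤ n * δ := by rw [mul_one, mul_comm]; exact mul_le_mul_of_nonneg_left (h k) (by positivity)

/-- The `β` terms cancel in the difference, and `x ↦ x^(L-1)` is `(L-1)`-Lipschitz on `[0,1]`. For
`L = 1` the constant is `0`, as `K(v)` is then independent of `v`. -/
theorem exists_KOp_lipschitz (hα : 0 < α) (hβ : 0 < β) (hw : w.Comparable) :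
    ∃ C : ℝ, 0 ≤ C ∧ ∀ v ∈ tails, ∀ v' ∈ tails, ∀ δ : ℝ, (∀ k, |v k - v' k| ≤ δ) →
      ‖KOp α β L w v - KOp α β L w v'‖ ≤ C * δ := by
  obtain ⟨κ, hκ0, hκ⟩ := exists_tridiagonal_bound hw
  obtain ⟨_, _, hK⟩ := exists_KOp_bound (L := L) hα hβ hw
  refine ⟨κ * (α * L * (L - 1 : ℕ)), by positivity, fun v hv v' hv' δ hδ => ?_⟩
  have hδ0 : 0 ≤ δ := (abs_nonneg _).trans (hδ 0)
  rw [mul_assoc κ]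
  refine ContinuousLinearMap.opNorm_le_bound _ (by positivity) fun x =>
    norm_le_of_tridiagonal hκ0 hκ (by positivity) fun k => ?_
  have hseq : ((KOp α β L w v - KOp α β L w v') x).seq =
      Kseq α β L v x.seq - Kseq α β L v' x.seq := by
    rw [← (hK v hv).1, ← (hK v' hv').1]; rfl
  rw [hseq]
  have h1 : (Kseq α β L v x.seq - Kseq α β L v' x.seq) (k + 1) =
      α * L * (v k ^ (L - 1) - v' k ^ (L - 1)) * x.seq k -
        α * L * (v (k + 1) ^ (L - 1) - v' (k + 1) ^ (L - 1)) * x.seq (k + 1) := by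
    simp only [Pi.sub_apply, Kseq]; ring
  rw [h1]
  have h2 : ∀ j, |α * L * (v j ^ (L - 1) - v' j ^ (L - 1)) * x.seq j| ≤
      α * L * (L - 1 : ℕ) * δ * |x.seq j| := by
    intro j
    rw [abs_mul, abs_mul, abs_of_nonneg (a := α * L) (by positivity), mul_assoc (α * L) _ δ]
    gcongr
    exact abs_pow_sub_pow_le_of_tails hv hv' hδ (L - 1) j
  have h3 : 0 ≤ α * L * (L - 1 : ℕ) * δ * |x.seq (k + 2)| := by positivity
  refine (abs_sub _ _).trans ?_
  have := h2 k
  have := h2 (k + 1)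
  linarith

/-! ### Regularity of the limit solution -/

theorem Fplus_nonneg (hα : 0 < α) {v : ℕ → ℝ} (hv : v ∈ tails) (k : ℕ) : 0 ≤ Fplus α L v k := by
  cases k with
  | zero => exact le_rfl
  | succ k =>
    exact mul_nonneg hα.le (sub_nonneg.2 (pow_le_pow_left₀ (tails_nonneg hv _) (hv.2.1 k) L))

theorem Fminus_nonneg (hβ : 0 < β) {v : ℕ → ℝ} (hv : v ∈ tails) (k : ℕ) : 0 ≤ Fminus β v k := by
  cases k with
  | zero => exact le_rfl
  | succ k => exact mul_nonneg hβ.le (sub_nonneg.2 (hv.2.1 (k + 1)))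

theorem Fplus_succ_le (hα : 0 < α) (hL : 1 ≤ L) {v : ℕ → ℝ} (hv : v ∈ tails) (k : ℕ) :
    Fplus α L v (k + 1) ≤ α * v k := by
  refine mul_le_mul_of_nonneg_left ?_ hα.le
  have h1 := pow_le_of_le_one (tails_nonneg hv k) (tails_le_one hv k) (n := L) (by omega)
  have h2 := tails_pow_nonneg hv (k + 1) L
  linarith

theorem Fminus_succ_le (hβ : 0 < β) {v : ℕ → ℝ} (hv : v ∈ tails) (k : ℕ) :
    Fminus β v (k + 1) ≤ β * v (k + 1) := by
  refine mul_le_mul_of_nonneg_left ?_ hβ.le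
  have := tails_nonneg hv (k + 2)
  linarith

theorem abs_Fplus_sub_Fminus_le (hα : 0 < α) (hβ : 0 < β) (hL : 1 ≤ L) {v : ℕ → ℝ}
    (hv : v ∈ tails) (k : ℕ) : |Fplus α L v k - Fminus β v k| ≤ α + β := by
  cases k with
  | zero => simp only [Fplus, Fminus, sub_self, abs_zero]; positivity
  | succ k =>
    have h1 := Fplus_succ_le hα hL hv k
    have h2 := Fminus_succ_le hβ hv k
    have h3 := Fplus_nonneg (L := L) hα hv (k + 1)
    have h4 := Fminus_nonneg hβ hv (k + 1)
    have h5 := tails_le_one hv k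
    have h6 := tails_le_one hv (k + 1)
    rw [abs_le]
    constructor <;> nlinarith

variable {u : ℝ → ℕ → ℝ}

/-- The drift is bounded uniformly in the coordinate, so the estimate holds in sup distance, as
`exists_KOp_lipschitz` requires. -/
theorem IsLimitSolution.abs_sub_le (hu : IsLimitSolution α β L u) (hα : 0 < α) (hβ : 0 < β)
    (hL : 1 ≤ L) {s t : ℝ} (hs : 0 ≤ s) (ht : 0 ≤ t) (k : ℕ) :
    |u t k - u s k| ≤ (α + β) * |t - s| := by
  have := (convex_Ici (0 : ℝ)).norm_image_sub_le_of_norm_hasDerivWithin_le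
    (f := fun t => u t k) (C := α + β) (fun r hr => hu.deriv r hr k)
    (fun r hr => abs_Fplus_sub_Fminus_le hα hβ hL (hu.mem r hr) k) hs ht
  exact this

/-- `r ↦ K(u_r)`, extended by a constant to negative times. -/
noncomputable def KPath (α β : ℝ) (L : ℕ) (w : Weight) (u : ℝ → ℕ → ℝ) (r : ℝ) : L2 w →L[ℝ] L2 w :=
  KOp α β L w (u (max r 0))

theorem KPath_of_nonneg {r : ℝ} (hr : 0 ≤ r) : KPath α β L w u r = KOp α β L w (u r) := by
  rw [KPath, max_eq_left hr]

theorem continuous_KPath (hα : 0 < α) (hβ : 0 < β) (hL : 1 ≤ L) (hw : w.Comparable)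
    (hu : IsLimitSolution α β L u) : Continuous (KPath α β L w u) := by
  obtain ⟨C, hC0, hC⟩ := exists_KOp_lipschitz (L := L) hα hβ hw
  refine (LipschitzWith.of_dist_le_mul (K := (C * (α + β)).toNNReal) fun r s => ?_).continuous
  rw [dist_eq_norm, Real.coe_toNNReal _ (by positivity), Real.dist_eq, mul_assoc]
  refine hC _ (hu.mem _ (le_max_right _ _)) _ (hu.mem _ (le_max_right _ _)) _ fun k => ?_
  refine (hu.abs_sub_le hα hβ hL (le_max_right _ _) (le_max_right _ _) k).trans ?_
  have := abs_max_sub_max_le_abs r s 0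
  gcongr

theorem evolution_eq {s t : ℝ} (hs : 0 ≤ s) (ht : 0 ≤ t) :
    evolution α β L w u s t = orderedExp (KPath α β L w u) s t :=
  orderedExp_congr fun r hr => by
    rw [KPath_of_nonneg ((le_min hs ht).trans hr.1)]

end SupermarketOU

namespace SupermarketOU

/-! ### Uniqueness for linear equations -/

section LinearUniqueness

variable {E : Type*} [NormedAddCommGroup E] [NormedSpace ℝ E] {A : ℝ → E →L[ℝ] E} {C : ℝ}

theorem linearODE_unique (hC : 0 ≤ C) (hAC : ∀ r, ‖A r‖ ≤ C) {f g : ℝ → E}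
    (hf : ∀ t, 0 ≤ t → HasDerivWithinAt f (A t (f t)) (Set.Ici 0) t)
    (hg : ∀ t, 0 ≤ t → HasDerivWithinAt g (A t (g t)) (Set.Ici 0) t) (h0 : f 0 = g 0)
    {t : ℝ} (ht : 0 ≤ t) : f t = g t := by
  refine ODE_solution_unique (v := fun t x => A t x) (K := C.toNNReal) (a := 0) (b := t)
    (fun t => ?_) (fun s hs => ?_) (fun s hs => ?_) (fun s hs => ?_) (fun s hs => ?_) h0 ⟨ht, le_rfl⟩
  · refine LipschitzWith.of_dist_le_mul fun x y => ?_
    rw [dist_eq_norm, dist_eq_norm, ← map_sub, Real.coe_toNNReal C hC]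
    exact (A t).le_of_opNorm_le (hAC t) _
  · exact (hf s hs.1).continuousWithinAt.mono Set.Icc_subset_Ici_self
  · exact (hf s hs.1).mono (Set.Ici_subset_Ici.2 hs.1)
  · exact (hg s hs.1).continuousWithinAt.mono Set.Icc_subset_Ici_self
  · exact (hg s hs.1).mono (Set.Ici_subset_Ici.2 hs.1)

theorem continuous_comp_max {X : Type*} [TopologicalSpace X] {D : ℝ → X} (hD : ContinuousOn D (Set.Ici 0)) :
    Continuous fun t => D (max t 0) :=
  hD.comp_continuous (continuous_id.max continuous_const) fun t => le_max_right t 0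

/-- Bootstrap: `D` is a primitive, hence continuous; then its integrand is continuous, so `D` is
differentiable and ODE uniqueness applies. -/
theorem linearVolterra_unique [CompleteSpace E] (hA : Continuous A) (hC : 0 ≤ C)
    (hAC : ∀ r, ‖A r‖ ≤ C) {D : ℝ → E}
    (hint : ∀ t, 0 ≤ t → IntervalIntegrable (fun s => A s (D s)) volume 0 t)
    (hD : ∀ t, 0 ≤ t → D t = ∫ s in (0 : ℝ)..t, A s (D s)) {t : ℝ} (ht : 0 ≤ t) : D t = 0 := by
  have hcont : ContinuousOn D (Set.Ici 0) := by
    intro t ht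
    have h1 : ContinuousOn (fun r => ∫ s in (0 : ℝ)..r, A s (D s)) (Set.uIcc 0 (t + 1)) :=
      intervalIntegral.continuousOn_primitive_interval
        ((intervalIntegrable_iff' (by simp)).1 (hint (t + 1) (by linarith [Set.mem_Ici.1 ht])))
    have ht' : (0 : ℝ) ≤ t := ht
    rw [Set.uIcc_of_le (by linarith)] at h1
    have h2 : ContinuousOn D (Set.Icc 0 (t + 1)) := h1.congr fun r hr => hD r hr.1
    refine (h2 t ⟨ht', by linarith⟩).mono_of_mem_nhdsWithin ?_
    rw [mem_nhdsWithin]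
    exact ⟨Set.Iio (t + 1), isOpen_Iio, by simp, fun r hr => ⟨hr.2, hr.1.le⟩⟩
  have hc : Continuous fun s => A s (D (max s 0)) := hA.clm_apply (continuous_comp_max hcont)
  let G : ℝ → E := fun t => ∫ s in (0 : ℝ)..t, A s (D (max s 0))
  have hDG : ∀ t, 0 ≤ t → D t = G t := fun t ht => by
    rw [hD t ht]
    refine intervalIntegral.integral_congr fun s hs => ?_
    rw [Set.uIcc_of_le ht] at hs
    simp only [max_eq_left hs.1]
  rw [hDG t ht]
  refine linearODE_unique hC hAC (f := G) (g := fun _ => 0) (fun t ht => ?_) (fun t _ => ?_)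
    (by simp [G]) ht
  · rw [← hDG t ht]
    have := intervalIntegral.integral_hasDerivAt_right (hc.intervalIntegrable 0 t)
      (hc.stronglyMeasurableAtFilter _ _) hc.continuousAt
    rw [max_eq_left ht] at this
    exact this.hasDerivWithinAt
  · simpa using hasDerivWithinAt_const t (Set.Ici 0) (0 : E)

end LinearUniqueness

/-! ### The linearized equation and pathwise uniqueness for (OU). -/

variable {w : Weight} {α β : ℝ} {L : ℕ} {u : ℝ → ℕ → ℝ}

theorem exists_KPath_bound (hα : 0 < α) (hβ : 0 < β) (hw : w.Comparable)
    (hu : IsLimitSolution α β L u) :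
    ∃ C : ℝ, 0 ≤ C ∧ ∀ r, ‖KPath α β L w u r‖ ≤ C := by
  obtain ⟨C, hC0, hC⟩ := exists_KOp_bound (L := L) hα hβ hw
  exact ⟨C, hC0, fun r => (hC _ (hu.mem _ (le_max_right _ _))).2⟩

theorem isLinearizedSolution_iff {z : ℝ → L2 w} :
    IsLinearizedSolution α β L w u z ↔
      ∀ t, 0 ≤ t → HasDerivWithinAt z (KPath α β L w u t (z t)) (Set.Ici 0) t :=
  forall₂_congr fun t ht => by rw [KPath_of_nonneg ht]

theorem isLinearizedSolution_evolution (hα : 0 < α) (hβ : 0 < β) (hL : 1 ≤ L) (hw : w.Comparable)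
    (hu : IsLimitSolution α β L u) (z₀ : L2 w) :
    IsLinearizedSolution α β L w u (fun t => evolution α β L w u 0 t z₀) := by
  obtain ⟨C, hC, hAC⟩ := exists_KPath_bound hα hβ hw hu
  rw [isLinearizedSolution_iff]
  intro t ht
  rw [evolution_eq le_rfl ht]
  have h := ((hasDerivAt_orderedExp (continuous_KPath hα hβ hL hw hu) hC hAC 0 t).clm_apply
    (hasDerivAt_const t z₀)).hasDerivWithinAt (s := Set.Ici 0)
  refine (h.congr_deriv (by rw [map_zero, add_zero]; rfl)).congr
    (fun r hr => by rw [evolution_eq le_rfl hr]) (by rw [evolution_eq le_rfl ht])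

theorem evolution_self (z₀ : L2 w) : evolution α β L w u 0 0 z₀ = z₀ := by
  rw [evolution, orderedExp_self]; rfl

theorem IsLinearizedSolution.eq_evolution (hα : 0 < α) (hβ : 0 < β) (hL : 1 ≤ L)
    (hw : w.Comparable) (hu : IsLimitSolution α β L u) {z : ℝ → L2 w}
    (hz : IsLinearizedSolution α β L w u z) {t : ℝ} (ht : 0 ≤ t) :
    z t = evolution α β L w u 0 t (z 0) := by
  obtain ⟨C, hC, hAC⟩ := exists_KPath_bound hα hβ hw hu
  exact linearODE_unique hC hAC (isLinearizedSolution_iff.1 hz)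
    (isLinearizedSolution_iff.1 (isLinearizedSolution_evolution hα hβ hL hw hu (z 0)))
    (evolution_self _).symm ht

theorem evolution_of_commute (hα : 0 < α) (hβ : 0 < β) (hL : 1 ≤ L) (hw : w.Comparable)
    (hu : IsLimitSolution α β L u) {s t : ℝ} (hs : 0 ≤ s) (hst : s ≤ t)
    (h : ∀ r ∈ Set.Icc s t, ∀ r' ∈ Set.Icc s t,
      Commute (KOp α β L w (u r)) (KOp α β L w (u r'))) :
    evolution α β L w u s t = NormedSpace.exp (∫ r in s..t, KOp α β L w (u r)) := by
  rw [evolution_eq hs (hs.trans hst), orderedExp_of_commute (continuous_KPath hα hβ hL hw hu)]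
  · congr 1
    refine intervalIntegral.integral_congr fun r hr => ?_
    rw [Set.uIcc_of_le hst] at hr
    exact KPath_of_nonneg (hs.trans hr.1)
  · intro r hr r' hr'
    rw [Set.uIcc_of_le hst] at hr hr'
    rw [KPath_of_nonneg (hs.trans hr.1), KPath_of_nonneg (hs.trans hr'.1)]
    exact h r hr r' hr'

/-- On a single full-measure event, valid for all `t`, the noise and the initial value cancel and
the difference solves a homogeneous Volterra equation. -/
theorem IsOUSolution.ae_eq (hα : 0 < α) (hβ : 0 < β) (hL : 1 ≤ L) (hw : w.Comparable)
    (hu : IsLimitSolution α β L u) {Ω : Type*} {mΩ : MeasurableSpace Ω} {P : Measure Ω}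
    {M : ℝ → Ω → ℕ → ℝ} {Z₀ : Ω → L2 w} {Z Z' : ℝ → Ω → L2 w}
    (hZ : IsOUSolution α β L w u P M Z₀ Z) (hZ' : IsOUSolution α β L w u P M Z₀ Z') :
    ∀ᵐ ω ∂P, ∀ t, 0 ≤ t → Z t ω = Z' t ω := by
  obtain ⟨C, hC, hAC⟩ := exists_KPath_bound hα hβ hw hu
  filter_upwards [hZ.integrable, hZ.equation, hZ'.integrable, hZ'.equation] with ω h1 h2 h3 h4 t ht
  have hEqOn : ∀ (Y : ℝ → L2 w) (t : ℝ), 0 ≤ t → Set.EqOn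
      (fun s => KOp α β L w (u s) (Y s)) (fun s => KPath α β L w u s (Y s)) (Set.uIcc 0 t) :=
    fun Y t ht s hs => by
      rw [Set.uIcc_of_le ht] at hs
      simp only [KPath_of_nonneg hs.1]
  have h1' : ∀ t, 0 ≤ t → IntervalIntegrable (fun s => KPath α β L w u s (Z s ω)) volume 0 t :=
    fun t ht => (h1 t ht).congr
      ((hEqOn (fun s => Z s ω) t ht).mono Set.uIoc_subset_uIcc)
  have h3' : ∀ t, 0 ≤ t → IntervalIntegrable (fun s => KPath α β L w u s (Z' s ω)) volume 0 t :=
    fun t ht => (h3 t ht).congr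
      ((hEqOn (fun s => Z' s ω) t ht).mono Set.uIoc_subset_uIcc)
  rw [← sub_eq_zero]
  refine linearVolterra_unique (continuous_KPath hα hβ hL hw hu) hC hAC
    (D := fun t => Z t ω - Z' t ω) (fun t ht => ?_) (fun t ht => L2.seq_injective ?_) ht
  · simp only [map_sub]
    exact (h1' t ht).sub (h3' t ht)
  · simp only [map_sub]
    rw [intervalIntegral.integral_sub (h1' t ht) (h3' t ht),
      ← intervalIntegral.integral_congr (hEqOn (fun s => Z s ω) t ht),
      ← intervalIntegral.integral_congr (hEqOn (fun s => Z' s ω) t ht)]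
    change (Z t ω).seq - (Z' t ω).seq = (L2.seq _) - (L2.seq _)
    rw [h2 t ht, h4 t ht]
    abel

end SupermarketOU

namespace SupermarketOU

/-! ### Doob's `L²` maximal inequality -/

section RunMax

/-- `max_{j ≤ i} |x_j|`. -/
def runMax (x : ℕ → ℝ) : ℕ → ℝ
  | 0 => |x 0|
  | i + 1 => max (runMax x i) |x (i + 1)|

theorem runMax_nonneg (x : ℕ → ℝ) (i : ℕ) : 0 ≤ runMax x i := by
  cases i with
  | zero => exact abs_nonneg _
  | succ i => exact le_max_of_le_right (abs_nonneg _)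

theorem abs_le_runMax (x : ℕ → ℝ) {i j : ℕ} (h : j ≤ i) : |x j| ≤ runMax x i := by
  induction i with
  | zero => rw [Nat.le_zero.1 h]; exact le_rfl
  | succ i ih =>
    rcases Nat.le_succ_iff.1 h with h | rfl
    · exact le_max_of_le_left (ih h)
    · exact le_max_right _ _

/-- The maximum moves only when the new `|x|` reaches it, and the discrepancy is then half the
square of its jump. -/
theorem sum_runMax_mul_le (x : ℕ → ℝ) (n : ℕ) :
    ∑ i ∈ Finset.range n, runMax x i * (|x (i + 1)| - |x i|) ≤
      runMax x n * |x n| - runMax x n ^ 2 / 2 := by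
  induction n with
  | zero => simp only [Finset.range_zero, Finset.sum_empty, runMax]; nlinarith [sq_nonneg |x 0|]
  | succ n ih =>
    rw [Finset.sum_range_succ]
    rcases le_total (runMax x n) |x (n + 1)| with h | h
    · simp only [runMax, max_eq_right h]
      nlinarith [sq_nonneg (runMax x n - |x (n + 1)|)]
    · simp only [runMax, max_eq_left h]
      nlinarith

theorem stronglyMeasurable_runMax {Ω : Type*} {m : MeasurableSpace Ω} {X : ℕ → Ω → ℝ} {n : ℕ}
    (h : ∀ j ≤ n, StronglyMeasurable (X j)) :
    StronglyMeasurable fun ω => runMax (fun j => X j ω) n := by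
  induction n with
  | zero => exact (h 0 le_rfl).norm
  | succ n ih => exact (ih fun j hj => h j (by omega)).sup (h (n + 1) le_rfl).norm

theorem memLp_runMax {Ω : Type*} {m : MeasurableSpace Ω} {P : Measure Ω} {X : ℕ → Ω → ℝ}
    (h : ∀ j, MemLp (X j) 2 P) (n : ℕ) : MemLp (fun ω => runMax (fun j => X j ω) n) 2 P := by
  induction n with
  | zero => exact (h 0).norm
  | succ n ih => exact ih.sup (h (n + 1)).norm

/-- The running maximum signed by the current value. -/
noncomputable def signedRunMax (x : ℕ → ℝ) (i : ℕ) : ℝ :=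
  if 0 ≤ x i then runMax x i else -runMax x i

/-- Pathwise form of Doob's inequality. The bound `sign(x)(y - x) ≤ |y| - |x|` turns the previous
sum into a martingale transform, and `(max - 2|x_n|)² ≥ 0` produces the constant `4`. -/
theorem sq_runMax_le (x : ℕ → ℝ) (n : ℕ) :
    runMax x n ^ 2 ≤ 4 * x n ^ 2 -
      4 * ∑ i ∈ Finset.range n, signedRunMax x i * (x (i + 1) - x i) := by
  have h1 : ∑ i ∈ Finset.range n, signedRunMax x i * (x (i + 1) - x i) ≤
      ∑ i ∈ Finset.range n, runMax x i * (|x (i + 1)| - |x i|) := by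
    refine Finset.sum_le_sum fun i _ => ?_
    have h0 := runMax_nonneg x i
    rw [signedRunMax]
    split_ifs with h
    · rw [abs_of_nonneg h]
      have := le_abs_self (x (i + 1))
      gcongr
    · rw [abs_of_neg (not_le.1 h), neg_mul, ← mul_neg]
      have := neg_abs_le (x (i + 1))
      refine mul_le_mul_of_nonneg_left ?_ h0
      linarith
  have h2 := sum_runMax_mul_le x n
  rw [← sq_abs (x n)]
  nlinarith [sq_nonneg (runMax x n - 2 * |x n|)]

end RunMax

section Doob

variable {Ω ι : Type*} [Preorder ι] {mΩ : MeasurableSpace Ω} {P : Measure Ω}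
  {ℱ : Filtration ι mΩ} {X : ι → Ω → ℝ}

theorem stronglyMeasurable_runMax_of_martingale (hX : Martingale X ℱ P) {τ : ℕ → ι} (hτ : Monotone τ)
    (n : ℕ) : StronglyMeasurable[ℱ (τ n)] fun ω => runMax (fun j => X (τ j) ω) n :=
  stronglyMeasurable_runMax fun j hj =>
    (hX.stronglyMeasurable (τ j)).mono (ℱ.mono (hτ hj))

theorem stronglyMeasurable_signedRunMax (hX : Martingale X ℱ P) {τ : ℕ → ι} (hτ : Monotone τ)
    (n : ℕ) : StronglyMeasurable[ℱ (τ n)] fun ω => signedRunMax (fun j => X (τ j) ω) n := by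
  refine StronglyMeasurable.ite ?_ (stronglyMeasurable_runMax_of_martingale hX hτ n)
    (stronglyMeasurable_runMax_of_martingale hX hτ n).neg
  exact (hX.stronglyMeasurable (τ n)).measurable measurableSet_Ici

variable [IsFiniteMeasure P]

/-- Conditioning on `ℱ s` pulls out `h`; this makes the martingale transform in `sq_runMax_le`
vanish in mean. -/
theorem integral_mul_sub_of_martingale (hX : Martingale X ℱ P) (h2 : ∀ t, MemLp (X t) 2 P)
    {s t : ι} (hst : s ≤ t) {h : Ω → ℝ} (hm : StronglyMeasurable[ℱ s] h) (hh : MemLp h 2 P) :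
    ∫ ω, h ω * (X t ω - X s ω) ∂P = 0 := by
  have hsub : MemLp (X t - X s) 2 P := (h2 t).sub (h2 s)
  have hint : Integrable (h * (X t - X s)) P := hh.integrable_mul hsub
  have h1 := condExp_mul_of_stronglyMeasurable_left hm hint (hsub.integrable (by norm_num))
  have h3 : P[X t - X s | ℱ s] =ᵐ[P] 0 := by
    refine (condExp_sub (hX.integrable t) (hX.integrable s) _).trans ?_
    filter_upwards [hX.condExp_ae_eq hst, hX.condExp_ae_eq (le_refl s)] with ω e1 e2
    simp [e1, e2]
  change ∫ ω, (h * (X t - X s)) ω ∂P = 0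
  rw [← integral_condExp (ℱ.le s)]
  refine integral_eq_zero_of_ae ?_
  filter_upwards [h1, h3] with ω e1 e2
  simp [e1, e2]

theorem integral_sq_runMax_le (hX : Martingale X ℱ P) (h2 : ∀ t, MemLp (X t) 2 P) {τ : ℕ → ι}
    (hτ : Monotone τ) (n : ℕ) :
    ∫ ω, runMax (fun j => X (τ j) ω) n ^ 2 ∂P ≤ 4 * ∫ ω, X (τ n) ω ^ 2 ∂P := by
  have hs : ∀ i, MemLp (fun ω => signedRunMax (fun j => X (τ j) ω) i) 2 P := fun i => by
    refine (memLp_runMax (fun j => h2 (τ j)) i).of_le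
      ((stronglyMeasurable_signedRunMax hX hτ i).mono (ℱ.le _)).aestronglyMeasurable
      (ae_of_all _ fun ω => ?_)
    rw [signedRunMax]
    split_ifs
    · exact le_rfl
    · rw [norm_neg]
  have hi : ∀ i, Integrable (fun ω => signedRunMax (fun j => X (τ j) ω) i *
      (X (τ (i + 1)) ω - X (τ i) ω)) P := fun i =>
    (hs i).integrable_mul ((h2 (τ (i + 1))).sub (h2 (τ i)))
  calc ∫ ω, runMax (fun j => X (τ j) ω) n ^ 2 ∂P
      ≤ ∫ ω, (4 * X (τ n) ω ^ 2 - 4 * ∑ i ∈ Finset.range n,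
          signedRunMax (fun j => X (τ j) ω) i * (X (τ (i + 1)) ω - X (τ i) ω)) ∂P :=
        integral_mono (memLp_runMax (fun j => h2 (τ j)) n).integrable_sq
          (((h2 (τ n)).integrable_sq.const_mul 4).sub
            ((integrable_finsetSum _ fun i _ => hi i).const_mul 4))
          fun ω => sq_runMax_le (fun j => X (τ j) ω) n
    _ = 4 * ∫ ω, X (τ n) ω ^ 2 ∂P := by
        rw [integral_sub ((h2 (τ n)).integrable_sq.const_mul 4)
            ((integrable_finsetSum _ fun i _ => hi i).const_mul 4),
          integral_const_mul, integral_const_mul, integral_finsetSum _ fun i _ => hi i,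
          Finset.sum_eq_zero fun i _ => integral_mul_sub_of_martingale hX h2
            (hτ (Nat.le_succ i)) (stronglyMeasurable_signedRunMax hX hτ i) (hs i)]
        ring

/-- Doob's `L²` maximal inequality for continuous martingales: the supremum over `[0, T]` has a
measurable majorant with the expected mean. -/
theorem exists_doob_majorant {ℱ : Filtration ℝ≥0 mΩ} {Y : ℝ → Ω → ℝ}
    (hY : Martingale (fun (t : ℝ≥0) ω => Y t ω) ℱ P) (h2 : ∀ t : ℝ≥0, MemLp (Y t) 2 P)
    (hc : ∀ᵐ ω ∂P, ContinuousOn (fun t => Y t ω) (Set.Ici 0)) (T : ℝ≥0) :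
    ∃ R : Ω → ℝ≥0∞, Measurable R ∧
      (∀ᵐ ω ∂P, ∀ t ∈ Set.Icc (0 : ℝ) T, ENNReal.ofReal (Y t ω ^ 2) ≤ R ω) ∧
      ∫⁻ ω, R ω ∂P ≤ ENNReal.ofReal (4 * ∫ ω, Y T ω ^ 2 ∂P) := by
  let τ : ℕ → ℕ → ℝ≥0 := fun N j => j / N * T
  have hτ : ∀ N, Monotone (τ N) := fun N i j hij => by
    simp only [τ]; gcongr
  let F : ℕ → Ω → ℝ≥0∞ := fun N ω => ENNReal.ofReal (runMax (fun j => Y (τ N j) ω) N ^ 2)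
  have hF : ∀ N, Measurable (F N) := fun N =>
    ((((stronglyMeasurable_runMax_of_martingale hY (hτ N) N).mono (ℱ.le _)).measurable).pow_const 2).ennreal_ofReal
  -- A liminf of maxima over uniform grids is measurable, dominates every `Y_t²` by path continuity,
  -- and has its mean controlled by Fatou.
  refine ⟨fun ω => liminf (fun N => F N ω) atTop, .liminf hF, ?_, ?_⟩
  · filter_upwards [hc] with ω hω t ht
    obtain ⟨x, hx, rfl⟩ : ∃ x ∈ Set.Icc (0 : ℝ) 1, x * T = t := by
      rcases eq_or_lt_of_le T.2 with hT | hT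
      · refine ⟨0, by simp, ?_⟩
        have : t ≤ 0 := ht.2.trans hT.symm.le
        rw [zero_mul]; exact le_antisymm ht.1 this
      · refine ⟨t / T, ⟨div_nonneg ht.1 T.2, div_le_one_of_le₀ ht.2 T.2⟩, ?_⟩
        exact div_mul_cancel₀ _ hT.ne'
    have h1 : Tendsto (fun N : ℕ => (⌊x * N⌋₊ : ℝ) / N * T) atTop (𝓝[Set.Ici 0] (x * T)) := by
      refine tendsto_nhdsWithin_iff.2 ⟨?_, Eventually.of_forall fun N => ?_⟩
      · exact (((tendsto_nat_floor_mul_div_atTop hx.1).comp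
          tendsto_natCast_atTop_atTop)).mul_const (T : ℝ)
      · exact mul_nonneg (by positivity) T.2
    have h3 : Tendsto (fun N : ℕ => ENNReal.ofReal (Y ((⌊x * N⌋₊ : ℝ) / N * T) ω ^ 2)) atTop
        (𝓝 (ENNReal.ofReal (Y (x * T) ω ^ 2))) :=
      ENNReal.tendsto_ofReal (((hω (x * T) ht.1).tendsto.comp h1).pow 2)
    rw [← h3.liminf_eq]
    refine liminf_le_liminf (Eventually.of_forall fun N => ENNReal.ofReal_le_ofReal ?_)
    rw [← sq_abs]
    have hle : ⌊x * N⌋₊ ≤ N := by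
      refine Nat.floor_le_of_le ?_
      exact mul_le_of_le_one_left (Nat.cast_nonneg N) hx.2
    have := abs_le_runMax (fun j => Y (τ N j) ω) hle
    simp only [τ] at this
    push_cast at this
    exact pow_le_pow_left₀ (abs_nonneg _) this 2
  · refine (lintegral_liminf_le hF).trans (liminf_le_of_frequently_le' ?_)
    -- The grid ends at `T` only for `N > 0`, since `0 / 0 = 0`.
    refine (eventually_gt_atTop 0).frequently.mono fun N hN => ?_
    rw [← ofReal_integral_eq_lintegral_ofReal (memLp_runMax (fun j => h2 (τ N j)) N).integrable_sq
      (ae_of_all _ fun ω => sq_nonneg _)]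
    refine ENNReal.ofReal_le_ofReal ((integral_sq_runMax_le hY h2 (hτ N) N).trans_eq ?_)
    have : τ N N = T := by
      simp only [τ]; rw [div_self (by positivity), one_mul]
    rw [this]

end Doob

/-! ### Second moments of the driving martingale. -/

variable {w : Weight} {α β : ℝ} {L : ℕ} {u : ℝ → ℕ → ℝ} {Ω : Type*} {mΩ : MeasurableSpace Ω}
  {P : Measure Ω} {ℱ : Filtration ℝ≥0 mΩ} {M : ℝ → Ω → ℕ → ℝ}

theorem IsDrivingMartingale.memLp [IsFiniteMeasure P] (hM : IsDrivingMartingale α β L u P ℱ M)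
    (k : ℕ) (t : ℝ≥0) : MemLp (fun ω => M t ω k) 2 P := by
  have hm := (((hM.martingale k).stronglyMeasurable t).mono (ℱ.le t)).aestronglyMeasurable (μ := P)
  refine (memLp_two_iff_integrable_sq hm).2 ?_
  have := ((hM.compensated k).integrable t).add (integrable_const (bracket α β L u k t))
  refine this.congr (ae_of_all _ fun ω => ?_)
  simp

/-- The compensated square has constant mean, which is zero at time `0`. -/
theorem IsDrivingMartingale.integral_sq [IsProbabilityMeasure P]
    (hM : IsDrivingMartingale α β L u P ℱ M) (k : ℕ) (t : ℝ≥0) :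
    ∫ ω, M t ω k ^ 2 ∂P = bracket α β L u k t := by
  have h1 := (hM.compensated k).setIntegral_eq (zero_le (a := t)) MeasurableSet.univ
  simp only [setIntegral_univ] at h1
  rw [integral_sub (hM.memLp k 0).integrable_sq (integrable_const _),
    integral_sub (hM.memLp k t).integrable_sq (integrable_const _)] at h1
  have h0 : ∫ ω, M (0 : ℝ≥0) ω k ^ 2 ∂P = 0 := by
    refine integral_eq_zero_of_ae ?_
    filter_upwards [hM.init k] with ω hω
    simp [hω]
  rw [h0] at h1
  simp [bracket] at h1
  rw [bracket]
  linarith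

theorem IsDrivingMartingale.exists_majorant [IsProbabilityMeasure P]
    (hM : IsDrivingMartingale α β L u P ℱ M) (k : ℕ) (T : ℝ≥0) :
    ∃ R : Ω → ℝ≥0∞, Measurable R ∧
      (∀ᵐ ω ∂P, ∀ t ∈ Set.Icc (0 : ℝ) T, ENNReal.ofReal (M t ω k ^ 2) ≤ R ω) ∧
      ∫⁻ ω, R ω ∂P ≤ ENNReal.ofReal (4 * bracket α β L u k T) := by
  rw [← hM.integral_sq k T]
  exact exists_doob_majorant (hM.martingale k) (hM.memLp k) (hM.continuous k) T

end SupermarketOU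

namespace SupermarketOU

variable {w : Weight} {α β : ℝ} {L : ℕ} {u : ℝ → ℕ → ℝ}

/-! ### Propagation of `ℓ₁(w)` bounds and summability of the brackets -/

/-- The boundary term is `v(0) / w(1) = 1 / w(1)`; shifting the weight in the others costs a factor
`d`. -/
theorem sum_shift_le {d : ℝ} (hd : ∀ k, 1 ≤ k → w k ≤ d * w (k + 1)) {v : ℕ → ℝ}
    (hv : v ∈ tails) (n : ℕ) :
    ∑ k ∈ Finset.range n, v k / w (k + 1) ≤
      1 / w 1 + d * ∑ k ∈ Finset.range n, v (k + 1) / w (k + 1) := by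
  have hterm : ∀ k, v (k + 1) / w (k + 2) ≤ d * (v (k + 1) / w (k + 1)) := fun k => by
    rw [← mul_div_assoc, div_le_div_iff₀ (w.pos (k + 1)) (w.pos k)]
    nlinarith [hd (k + 1) (by omega), tails_nonneg hv (k + 1)]
  have hd0 : 0 ≤ d := by
    have h1 := hd 1 le_rfl
    have h2 := w.pos 0
    have h3 := w.pos 1
    by_contra h
    nlinarith [mul_pos (neg_pos.2 (not_le.1 h)) h3]
  cases n with
  | zero => simpa using (w.pos 0).le
  | succ n =>
    rw [Finset.sum_range_succ']
    have h1 : ∑ k ∈ Finset.range n, v (k + 1) / w (k + 1 + 1) ≤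
        d * ∑ k ∈ Finset.range n, v (k + 1) / w (k + 1) := by
      rw [Finset.mul_sum]
      exact Finset.sum_le_sum fun k _ => hterm k
    have h2 : 0 ≤ d * (v (n + 1) / w (n + 1)) :=
      mul_nonneg hd0 (div_nonneg (tails_nonneg hv _) (w.pos n).le)
    rw [Finset.sum_range_succ, mul_add, zero_add, hv.1]
    linarith

/-- Since `F₋ ≥ 0` may be dropped and `F₊(k+1) ≤ α v(k)` looks only to the left, truncated sums
satisfy a closed inequality `S' ≤ α d S + α / w(1)`. Grönwall then gives a bound independent of the
truncation, with no infinite series to differentiate. -/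
theorem IsLimitSolution.exists_sum_le (hu : IsLimitSolution α β L u) (hα : 0 < α) (hβ : 0 < β)
    (hL : 1 ≤ L) (hw : w.Comparable) (h0 : AbsSummable w (u 0)) (T : ℝ) :
    ∃ B : ℝ, ∀ t ∈ Set.Icc 0 T, ∀ n, ∑ k ∈ Finset.range n, u t (k + 1) / w (k + 1) ≤ B := by
  obtain ⟨c, d, hc, hd, hcd⟩ := hw
  have hd' : ∀ k, 1 ≤ k → w k ≤ d * w (k + 1) := fun k hk => (hcd k hk).2
  have hw1 : 0 < w 1 := w.pos 0
  set δ : ℝ := ∑' k, |u 0 (k + 1)| / w (k + 1)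
  have hδ0 : 0 ≤ δ := tsum_nonneg fun k => div_nonneg (abs_nonneg _) (w.pos k).le
  refine ⟨gronwallBound δ (α * d) (α / w 1) T, fun t ht n => ?_⟩
  let S : ℝ → ℝ := fun t => ∑ k ∈ Finset.range n, u t (k + 1) / w (k + 1)
  let S' : ℝ → ℝ := fun t => ∑ k ∈ Finset.range n,
    (Fplus α L (u t) (k + 1) - Fminus β (u t) (k + 1)) / w (k + 1)
  have hS : ∀ t, 0 ≤ t → HasDerivWithinAt S (S' t) (Set.Ici 0) t := fun t ht =>
    HasDerivWithinAt.fun_sum fun k _ => (hu.deriv t ht (k + 1)).div_const _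
  have key := le_gronwallBound_of_liminf_deriv_right_le (f := S) (f' := S') (δ := δ) (K := α * d)
    (ε := α / w 1) (a := 0) (b := T)
    (fun s hs => (hS s hs.1).continuousWithinAt.mono Set.Icc_subset_Ici_self)
    (fun s hs r hr => ((hS s hs.1).mono (Set.Ici_subset_Ici.2 hs.1)).liminf_right_slope_le hr)
    ?_ ?_ t ht
  · refine key.trans ?_
    rw [sub_zero]
    exact gronwallBound_mono hδ0 (by positivity) (by positivity) ht.2
  · refine (Finset.sum_le_sum fun k _ => ?_).trans
      (h0.sum_le_tsum _ fun k _ => div_nonneg (abs_nonneg _) (w.pos k).le)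
    exact div_le_div_of_nonneg_right (le_abs_self _) (w.pos k).le
  · intro s hs
    have hv := hu.mem s hs.1
    have h1 : S' s ≤ α * ∑ k ∈ Finset.range n, u s k / w (k + 1) := by
      rw [Finset.mul_sum]
      refine Finset.sum_le_sum fun k _ => ?_
      rw [← mul_div_assoc]
      refine div_le_div_of_nonneg_right ?_ (w.pos k).le
      linarith [Fplus_succ_le hα hL hv k, Fminus_nonneg hβ hv (k + 1)]
    have h2 := mul_le_mul_of_nonneg_left (sum_shift_le hd' hv n) hα.le
    calc S' s ≤ _ := h1.trans h2
      _ = α * d * S s + α / w 1 := by simp only [S]; ring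

theorem IsLimitSolution.continuousOn (hu : IsLimitSolution α β L u) (k : ℕ) :
    ContinuousOn (fun t => u t k) (Set.Ici 0) :=
  fun t ht => (hu.deriv t ht k).continuousWithinAt

theorem IsLimitSolution.continuousOn_bracket_density (hu : IsLimitSolution α β L u) (k : ℕ) :
    ContinuousOn (fun s => Fplus α L (u s) k + Fminus β (u s) k) (Set.Ici 0) := by
  have h := hu.continuousOn
  cases k with
  | zero => simp only [Fplus, Fminus]; exact continuousOn_const
  | succ k =>
    simp only [Fplus, Fminus]
    exact (continuousOn_const.mul (((h k).pow L).sub ((h (k + 1)).pow L))).add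
      (continuousOn_const.mul ((h (k + 1)).sub (h (k + 2))))

theorem IsLimitSolution.bracket_nonneg (hu : IsLimitSolution α β L u) (hα : 0 < α) (hβ : 0 < β)
    (k : ℕ) {t : ℝ} (ht : 0 ≤ t) : 0 ≤ bracket α β L u k t :=
  intervalIntegral.integral_nonneg ht fun s hs =>
    add_nonneg (Fplus_nonneg hα (hu.mem s hs.1) k) (Fminus_nonneg hβ (hu.mem s hs.1) k)

theorem bracket_zero (t : ℝ) : bracket α β L u 0 t = 0 := by
  simp [bracket, Fplus, Fminus]

theorem IsLimitSolution.summable_bracket (hu : IsLimitSolution α β L u) (hα : 0 < α) (hβ : 0 < β)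
    (hL : 1 ≤ L) (hw : w.Comparable) (h0 : AbsSummable w (u 0)) {T : ℝ} (hT : 0 ≤ T) :
    Summable fun k => bracket α β L u (k + 1) T / w (k + 1) := by
  obtain ⟨B, hB⟩ := hu.exists_sum_le hα hβ hL hw h0 T
  obtain ⟨c, d, hc, hd, hcd⟩ := hw
  refine summable_of_sum_range_le (c := (α * (1 / w 1 + d * B) + β * B) * (T - 0))
    (fun k => div_nonneg (hu.bracket_nonneg hα hβ _ hT) (w.pos k).le) fun n => ?_
  have hint : ∀ k, IntervalIntegrable
      (fun s => (Fplus α L (u s) (k + 1) + Fminus β (u s) (k + 1)) / w (k + 1)) volume 0 T :=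
    fun k => (((hu.continuousOn_bracket_density (k + 1)).mono (by
      rw [Set.uIcc_of_le hT]; exact Set.Icc_subset_Ici_self)).intervalIntegrable).div_const _
  simp only [bracket, ← intervalIntegral.integral_div]
  rw [← intervalIntegral.integral_finsetSum fun k _ => hint k, ← smul_eq_mul, smul_eq_mul, mul_comm,
    ← smul_eq_mul, ← intervalIntegral.integral_const]
  have hsum := IntervalIntegrable.sum (Finset.range n) fun k _ => hint k
  rw [Finset.sum_fn] at hsum
  refine intervalIntegral.integral_mono_on hT hsum intervalIntegrable_const fun s hs => ?_
  have hv := hu.mem s hs.1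
  have h1 : ∑ k ∈ Finset.range n,
      (Fplus α L (u s) (k + 1) + Fminus β (u s) (k + 1)) / w (k + 1) ≤
      α * ∑ k ∈ Finset.range n, u s k / w (k + 1) +
        β * ∑ k ∈ Finset.range n, u s (k + 1) / w (k + 1) := by
    rw [Finset.mul_sum, Finset.mul_sum, ← Finset.sum_add_distrib]
    refine Finset.sum_le_sum fun k _ => ?_
    rw [← mul_div_assoc, ← mul_div_assoc, ← add_div]
    exact div_le_div_of_nonneg_right
      (add_le_add (Fplus_succ_le hα hL hv k) (Fminus_succ_le hβ hv k)) (w.pos k).le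
  have h2 := mul_le_mul_of_nonneg_left (sum_shift_le (fun k hk => (hcd k hk).2) hv n) hα.le
  have h3 := hB s hs n
  have h4 := mul_le_mul_of_nonneg_left (mul_le_mul_of_nonneg_left h3 hd.le) hα.le
  have h5 := mul_le_mul_of_nonneg_left h3 hβ.le
  simp only [mul_add] at h2 ⊢
  linarith

/-! ### Measurability of `toL2` -/

theorem sqSummable_single (k : ℕ) : SqSummable w (Pi.single (k + 1) (1 : ℝ)) :=
  summable_of_ne_finset_zero (s := {k}) fun j hj => by
    rw [Finset.mem_singleton] at hj
    simp [hj]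

theorem seq_sum_single (x : ℕ → ℝ) (n j : ℕ) :
    (∑ k ∈ Finset.range n, x (k + 1) • toL2 w (Pi.single (k + 1) (1 : ℝ))).seq (j + 1) =
      if j < n then x (j + 1) else 0 := by
  induction n with
  | zero => simp [L2.seq_zero]
  | succ n ih =>
    rw [Finset.sum_range_succ, L2.seq_add, L2.seq_smul, Pi.add_apply, ih, Pi.smul_apply,
      toL2_seq (by simp) (sqSummable_single n), smul_eq_mul, Pi.single_apply]
    by_cases h1 : j < n
    · simp [h1, h1.ne, h1.trans (Nat.lt_succ_self n)]
    · by_cases h2 : j = n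
      · simp [h2]
      · have : ¬ j < n + 1 := by omega
        simp [h1, h2, this]

theorem tendsto_sum_single {x : ℕ → ℝ} (h0 : x 0 = 0) (hx : SqSummable w x) :
    Tendsto (fun n => ∑ k ∈ Finset.range n, x (k + 1) • toL2 w (Pi.single (k + 1) (1 : ℝ))) atTop
      (𝓝 (toL2 w x)) := by
  rw [tendsto_iff_norm_sub_tendsto_zero]
  have h : Tendsto (fun n => ‖(∑ k ∈ Finset.range n,
      x (k + 1) • toL2 w (Pi.single (k + 1) (1 : ℝ))) - toL2 w x‖ ^ 2) atTop (𝓝 0) := by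
    simp only [L2.norm_sq]
    rw [show 𝓝 (0 : ℝ) = 𝓝 (∑' _ : ℕ, (0 : ℝ)) by rw [tsum_zero]]
    have hterm : ∀ n j, ((∑ k ∈ Finset.range n,
        x (k + 1) • toL2 w (Pi.single (k + 1) (1 : ℝ))) - toL2 w x).seq (j + 1) =
        if j < n then 0 else -x (j + 1) := fun n j => by
      change (∑ k ∈ Finset.range n, x (k + 1) • toL2 w (Pi.single (k + 1) (1 : ℝ))).seq (j + 1) -
        (toL2 w x).seq (j + 1) = _
      rw [seq_sum_single, toL2_seq h0 hx]
      split_ifs <;> simp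
    refine tendsto_tsum_of_dominated_convergence hx (fun j => ?_)
      (Eventually.of_forall fun n j => ?_)
    · refine tendsto_const_nhds.congr' ?_
      filter_upwards [eventually_gt_atTop j] with n hn
      simp [hterm, hn]
    · rw [hterm, Real.norm_of_nonneg (div_nonneg (sq_nonneg _) (w.pos j).le)]
      refine div_le_div_of_nonneg_right ?_ (w.pos j).le
      split_ifs
      · simpa using sq_nonneg (x (j + 1))
      · rw [neg_sq]
  have h2 := h.sqrt
  simpa [Real.sqrt_sq (norm_nonneg _)] using h2

theorem measurableSet_l2Submodule (w : Weight) : MeasurableSet (l2Submodule w : Set (ℕ → ℝ)) := by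
  have h : (l2Submodule w : Set (ℕ → ℝ)) = {x | x 0 = 0} ∩
      {x | ∑' k, ENNReal.ofReal (x (k + 1) ^ 2 / w (k + 1)) < ⊤} := by
    ext x
    refine and_congr Iff.rfl ⟨fun h => h.tsum_ofReal_lt_top, fun h => ?_⟩
    refine (ENNReal.summable_toReal (ne_of_lt h)).congr fun k => ?_
    rw [ENNReal.toReal_ofReal (div_nonneg (sq_nonneg _) (w.pos k).le)]
  rw [h]
  refine (measurableSet_eq_fun (measurable_pi_apply 0) measurable_const).inter
    (measurableSet_lt (Measurable.tsum fun k => ?_) measurable_const)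
  exact (((measurable_pi_apply (k + 1)).pow_const 2).div_const _).ennreal_ofReal

/-- On the measurable subspace `toL2` is the limit of finite truncations, each measurable in the
coordinates; off it, `toL2` is zero. -/
theorem stronglyMeasurable_toL2 (w : Weight) : StronglyMeasurable (toL2 w) := by
  classical
  refine stronglyMeasurable_of_tendsto atTop (f := fun n x => if x ∈ (l2Submodule w : Set (ℕ → ℝ))
    then ∑ k ∈ Finset.range n, x (k + 1) • toL2 w (Pi.single (k + 1) (1 : ℝ)) else 0)
    (fun n => ?_) ?_
  · refine StronglyMeasurable.ite (measurableSet_l2Submodule w) ?_ stronglyMeasurable_const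
    exact Finset.stronglyMeasurable_fun_sum _ fun k _ =>
      ((measurable_pi_apply (k + 1)).stronglyMeasurable).smul_const _
  · rw [tendsto_pi_nhds]
    intro x
    by_cases hx : x ∈ (l2Submodule w : Set (ℕ → ℝ))
    · simp only [hx, if_true]
      exact tendsto_sum_single hx.1 hx.2
    · simp only [hx, if_false]
      have h0 : toL2 w x = 0 := dif_neg hx
      rw [h0]
      exact tendsto_const_nhds

/-! ### The driving martingale as a continuous process in `L₂(w)` -/

/-- Dominated convergence in the coordinate sum: coordinatewise continuity is enough once a summable
majorant holds on bounded time intervals. -/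
theorem continuousOn_toL2 {m : ℝ → ℕ → ℝ} (h0 : ∀ t, 0 ≤ t → m t 0 = 0)
    (hc : ∀ k, ContinuousOn (fun t => m t k) (Set.Ici 0))
    (hb : ∀ n : ℕ, ∃ b : ℕ → ℝ, Summable b ∧
      ∀ t ∈ Set.Icc (0 : ℝ) n, ∀ k, m t (k + 1) ^ 2 / w (k + 1) ≤ b k) :
    (∀ t, 0 ≤ t → SqSummable w (m t)) ∧ ContinuousOn (fun t => toL2 w (m t)) (Set.Ici 0) := by
  have hs : ∀ t, 0 ≤ t → SqSummable w (m t) := fun t ht => by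
    obtain ⟨n, hn⟩ := exists_nat_ge t
    obtain ⟨b, hbs, hbm⟩ := hb n
    exact Summable.of_nonneg_of_le (fun k => div_nonneg (sq_nonneg _) (w.pos k).le)
      (hbm t ⟨ht, hn⟩) hbs
  refine ⟨hs, fun t ht => ?_⟩
  have ht' : (0 : ℝ) ≤ t := ht
  obtain ⟨n, hn⟩ := exists_nat_gt t
  obtain ⟨b, hbs, hbm⟩ := hb n
  have hev : ∀ᶠ s in 𝓝[Set.Ici 0] t, s ∈ Set.Icc (0 : ℝ) n := by
    filter_upwards [self_mem_nhdsWithin, mem_nhdsWithin_of_mem_nhds (Iio_mem_nhds hn)] with s h1 h2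
    exact ⟨h1, le_of_lt h2⟩
  rw [ContinuousWithinAt, tendsto_iff_norm_sub_tendsto_zero]
  have h : Tendsto (fun s => ‖toL2 w (m s) - toL2 w (m t)‖ ^ 2) (𝓝[Set.Ici 0] t) (𝓝 0) := by
    simp only [L2.norm_sq]
    rw [show 𝓝 (0 : ℝ) = 𝓝 (∑' _ : ℕ, (0 : ℝ)) by rw [tsum_zero]]
    have hterm : ∀ s, 0 ≤ s → ∀ k, (toL2 w (m s) - toL2 w (m t)).seq (k + 1) =
        m s (k + 1) - m t (k + 1) := fun s hs0 k => by
      change (toL2 w (m s)).seq (k + 1) - (toL2 w (m t)).seq (k + 1) = _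
      rw [toL2_seq (h0 s hs0) (hs s hs0), toL2_seq (h0 t ht') (hs t ht')]
    refine tendsto_tsum_of_dominated_convergence (hbs.mul_left 4) (fun k => ?_) ?_
    · have h1 : Tendsto (fun s => (m s (k + 1) - m t (k + 1)) ^ 2 / w (k + 1)) (𝓝[Set.Ici 0] t)
          (𝓝 ((m t (k + 1) - m t (k + 1)) ^ 2 / w (k + 1))) :=
        (((hc (k + 1) t ht).sub_const _).pow 2).div_const _
      rw [sub_self, zero_pow two_ne_zero, zero_div] at h1
      refine h1.congr' ?_
      filter_upwards [hev] with s hs0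
      rw [hterm s hs0.1]
    · filter_upwards [hev] with s hs0 k
      rw [hterm s hs0.1, Real.norm_of_nonneg (div_nonneg (sq_nonneg _) (w.pos k).le)]
      have h1 := hbm s hs0 k
      have h2 := hbm t ⟨ht', hn.le⟩ k
      have h3 : (m s (k + 1) - m t (k + 1)) ^ 2 / w (k + 1) ≤
          (2 * m s (k + 1) ^ 2 + 2 * m t (k + 1) ^ 2) / w (k + 1) :=
        div_le_div_of_nonneg_right (by nlinarith [sq_nonneg (m s (k + 1) + m t (k + 1))])
          (w.pos k).le
      rw [add_div, mul_div_assoc, mul_div_assoc] at h3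
      linarith
  have h2 := h.sqrt
  simpa [Real.sqrt_sq (norm_nonneg _)] using h2

variable {Ω : Type*} {mΩ : MeasurableSpace Ω} {P : Measure Ω} [IsProbabilityMeasure P]
  {ℱ : Filtration ℝ≥0 mΩ} {M : ℝ → Ω → ℕ → ℝ}

/-- Doob is applied in each coordinate and the bounds are summed by Tonelli. Controlling coordinates
separately serves both the dominated convergence for path continuity and the moment of the supremum.
-/
theorem IsDrivingMartingale.exists_summable_majorant (hM : IsDrivingMartingale α β L u P ℱ M)
    (hu : IsLimitSolution α β L u) (hα : 0 < α) (hβ : 0 < β)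
    (hL : 1 ≤ L) (hw : w.Comparable) (h0 : AbsSummable w (u 0)) (T : ℝ≥0) :
    ∃ b : ℕ → Ω → ℝ≥0∞,
      (∀ᵐ ω ∂P, ∀ k, ∀ t ∈ Set.Icc (0 : ℝ) T,
        ENNReal.ofReal (M t ω (k + 1) ^ 2 / w (k + 1)) ≤ b k ω) ∧
      (∀ᵐ ω ∂P, ∑' k, b k ω < ⊤) ∧ ∫⁻ ω, ∑' k, b k ω ∂P < ⊤ := by
  choose R hRm hR hRint using fun k => hM.exists_majorant (k + 1) T
  have hm : ∀ k, Measurable fun ω => ENNReal.ofReal (w (k + 1))⁻¹ * R k ω := fun k =>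
    (hRm k).const_mul _
  have hfin : ∫⁻ ω, ∑' k, ENNReal.ofReal (w (k + 1))⁻¹ * R k ω ∂P < ⊤ := by
    rw [lintegral_tsum fun k => (hm k).aemeasurable]
    refine lt_of_le_of_lt (ENNReal.tsum_le_tsum fun k => ?_)
      ((hu.summable_bracket hα hβ hL hw h0 T.2).mul_left 4).tsum_ofReal_lt_top
    rw [lintegral_const_mul _ (hRm k)]
    refine (mul_le_mul_right (hRint k) _).trans_eq ?_
    rw [← ENNReal.ofReal_mul (inv_nonneg.2 (w.pos k).le)]
    congr 1
    rw [div_eq_mul_inv]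
    change _ = 4 * (bracket α β L u (k + 1) T * _)
    ring
  refine ⟨fun k ω => ENNReal.ofReal (w (k + 1))⁻¹ * R k ω, ?_,
    ae_lt_top (Measurable.tsum hm) hfin.ne, hfin⟩
  rw [ae_all_iff]
  intro k
  filter_upwards [hR k] with ω hω t ht
  rw [div_eq_inv_mul, ENNReal.ofReal_mul (inv_nonneg.2 (w.pos k).le)]
  exact mul_le_mul_right (hω t ht) _

/-- A zero bracket makes Doob's majorant vanish; elements of `L₂(w)` must have zeroth coordinate
`0`. -/
theorem IsDrivingMartingale.ae_zero_coord (hM : IsDrivingMartingale α β L u P ℱ M) :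
    ∀ᵐ ω ∂P, ∀ t, 0 ≤ t → M t ω 0 = 0 := by
  have h : ∀ n : ℕ, ∀ᵐ ω ∂P, ∀ t ∈ Set.Icc (0 : ℝ) n, M t ω 0 = 0 := fun n => by
    obtain ⟨R, hRm, hR, hRint⟩ := hM.exists_majorant 0 n
    rw [bracket_zero, mul_zero, ENNReal.ofReal_zero, nonpos_iff_eq_zero,
      lintegral_eq_zero_iff hRm] at hRint
    filter_upwards [hR, hRint] with ω h1 h2 t ht
    have := h1 t (by simpa using ht)
    rw [h2, Pi.zero_apply, nonpos_iff_eq_zero, ENNReal.ofReal_eq_zero] at this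
    exact pow_eq_zero_iff two_ne_zero |>.1 (le_antisymm this (sq_nonneg _))
  filter_upwards [ae_all_iff.2 h] with ω hω t ht
  obtain ⟨n, hn⟩ := exists_nat_ge t
  exact hω n t ⟨ht, hn⟩

/-- Almost surely `M` is a continuous path in `L₂(w)` started at `0`. -/
theorem IsDrivingMartingale.ae_path (hM : IsDrivingMartingale α β L u P ℱ M)
    (hu : IsLimitSolution α β L u) (hα : 0 < α) (hβ : 0 < β)
    (hL : 1 ≤ L) (hw : w.Comparable) (h0 : AbsSummable w (u 0)) :
    ∀ᵐ ω ∂P, (∀ t, 0 ≤ t → (toL2 w (M t ω)).seq = M t ω) ∧ toL2 w (M 0 ω) = 0 ∧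
      ContinuousOn (fun t => toL2 w (M t ω)) (Set.Ici 0) := by
  choose b hb hbfin _ using fun n : ℕ =>
    hM.exists_summable_majorant hu hα hβ hL hw h0 (n : ℝ≥0)
  filter_upwards [hM.ae_zero_coord, ae_all_iff.2 hM.continuous, ae_all_iff.2 hb,
    ae_all_iff.2 hbfin, ae_all_iff.2 hM.init] with ω hz hc hbω hfin hi
  have key := continuousOn_toL2 (w := w) hz hc fun n =>
    ⟨fun k => (b n k ω).toReal, ENNReal.summable_toReal (hfin n).ne, fun t ht k => by
      rw [← ENNReal.ofReal_le_iff_le_toReal (ENNReal.ne_top_of_tsum_ne_top (hfin n).ne k)]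
      exact hbω n k t (by simpa using ht)⟩
  have hseq : ∀ t, 0 ≤ t → (toL2 w (M t ω)).seq = M t ω := fun t ht => toL2_seq (hz t ht) (key.1 t ht)
  refine ⟨hseq, L2.seq_injective ?_, key.2⟩
  rw [hseq 0 le_rfl]
  exact funext hi

theorem IsDrivingMartingale.exists_sup_norm_majorant (hM : IsDrivingMartingale α β L u P ℱ M)
    (hu : IsLimitSolution α β L u) (hα : 0 < α) (hβ : 0 < β)
    (hL : 1 ≤ L) (hw : w.Comparable) (h0 : AbsSummable w (u 0)) (T : ℝ≥0) :
    ∃ R : Ω → ℝ≥0∞,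
      (∀ᵐ ω ∂P, ∀ t ∈ Set.Icc (0 : ℝ) T, ‖toL2 w (M t ω)‖ₑ ^ 2 ≤ R ω) ∧ ∫⁻ ω, R ω ∂P < ⊤ := by
  obtain ⟨b, hb, _, hint⟩ := hM.exists_summable_majorant hu hα hβ hL hw h0 T
  refine ⟨fun ω => ∑' k, b k ω, ?_, hint⟩
  filter_upwards [hM.ae_path hu hα hβ hL hw h0, hb] with ω hp hbω t ht
  rw [← ofReal_norm, ← ENNReal.ofReal_pow (norm_nonneg _), L2.norm_sq,
    ENNReal.ofReal_tsum_of_nonneg (fun k => div_nonneg (sq_nonneg _) (w.pos k).le)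
      (toL2 w (M t ω)).sqSummable, hp.1 t ht.1]
  exact ENNReal.tsum_le_tsum fun k => hbω k t ht

end SupermarketOU

namespace SupermarketOU

variable {w : Weight} {α β : ℝ} {L : ℕ} {u : ℝ → ℕ → ℝ}

/-! ### The Ornstein-Uhlenbeck equation along a fixed continuous path -/

/-- The integral `∫_0^t e^{∫_s^t K(u_r) dr} dn_s` along a path `n` null at `0`, defined through
integration by parts. -/
noncomputable def pathIntegral (α β : ℝ) (L : ℕ) (w : Weight) (u : ℝ → ℕ → ℝ) (n : ℝ → L2 w)
    (t : ℝ) : L2 w :=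
  n t + ∫ s in (0 : ℝ)..t, evolution α β L w u s t (KOp α β L w (u s) (n s))

/-- The solution of the Ornstein-Uhlenbeck equation driven by the path `n` and started at `z₀`. -/
noncomputable def pathSolution (α β : ℝ) (L : ℕ) (w : Weight) (u : ℝ → ℕ → ℝ) (z₀ : L2 w)
    (n : ℝ → L2 w) (t : ℝ) : L2 w :=
  evolution α β L w u 0 t z₀ + pathIntegral α β L w u n t

theorem pathIntegral_eq {n : ℝ → L2 w} {t : ℝ} (ht : 0 ≤ t) :
    pathIntegral α β L w u n t = n (max t 0) + ∫ s in (0 : ℝ)..t,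
      orderedExp (KPath α β L w u) s t (KPath α β L w u s (n (max s 0))) := by
  rw [pathIntegral, max_eq_left ht]
  congr 1
  refine intervalIntegral.integral_congr fun s hs => ?_
  rw [Set.uIcc_of_le ht] at hs
  simp only [evolution_eq hs.1 ht, KPath_of_nonneg hs.1, max_eq_left hs.1]

section

variable (hα : 0 < α) (hβ : 0 < β) (hL : 1 ≤ L) (hw : w.Comparable) (hu : IsLimitSolution α β L u)

include hα hβ hL hw hu

/-- The path `n` need not be differentiable, but `Y = Z - n` is, with `Y' = A Y + A n`; so variation
of constants applies with forcing `A n`. -/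
theorem pathSolution_spec {n : ℝ → L2 w} (hn : ContinuousOn n (Set.Ici 0)) (z₀ : L2 w) :
    ContinuousOn (pathSolution α β L w u z₀ n) (Set.Ici 0) ∧
    ∀ t, 0 ≤ t →
      IntervalIntegrable (fun s => KOp α β L w (u s) (pathSolution α β L w u z₀ n s)) volume 0 t ∧
      pathSolution α β L w u z₀ n t = z₀ +
        (∫ s in (0 : ℝ)..t, KOp α β L w (u s) (pathSolution α β L w u z₀ n s)) + n t := by
  obtain ⟨C, hC, hAC⟩ := exists_KPath_bound hα hβ hw hu
  have hA := continuous_KPath hα hβ hL hw hu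
  set A := KPath α β L w u
  have hn' : Continuous fun s => n (max s 0) := continuous_comp_max hn
  let Y : ℝ → L2 w := fun t => orderedExp A 0 t z₀ +
    ∫ s in (0 : ℝ)..t, orderedExp A s t (A s (n (max s 0)))
  have hY : ∀ t, HasDerivAt Y (A t (Y t) + A t (n (max t 0))) t :=
    hasDerivAt_duhamel hA hC hAC (hA.clm_apply hn') z₀
  have hYc : Continuous Y := continuous_iff_continuousAt.2 fun t => (hY t).continuousAt
  have hZ : ∀ t, 0 ≤ t → pathSolution α β L w u z₀ n t = Y t + n (max t 0) := fun t ht => by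
    rw [pathSolution, pathIntegral_eq ht, evolution_eq le_rfl ht]
    simp only [Y, A]
    abel
  have hint : Continuous fun t => A t (Y t) + A t (n (max t 0)) :=
    (hA.clm_apply hYc).add (hA.clm_apply hn')
  refine ⟨(hYc.add hn').continuousOn.congr hZ, fun t ht => ?_⟩
  have hEq : Set.EqOn (fun s => A s (Y s) + A s (n (max s 0)))
      (fun s => KOp α β L w (u s) (pathSolution α β L w u z₀ n s)) (Set.uIcc 0 t) := fun s hs => by
    rw [Set.uIcc_of_le ht] at hs
    simp only [hZ s hs.1, map_add, A, KPath_of_nonneg hs.1]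
  refine ⟨(hint.intervalIntegrable 0 t).congr (hEq.mono Set.uIoc_subset_uIcc), ?_⟩
  rw [← intervalIntegral.integral_congr hEq,
    intervalIntegral.integral_eq_sub_of_hasDerivAt (fun s _ => hY s) (hint.intervalIntegrable 0 t),
    hZ t ht, max_eq_left ht]
  have h0 : Y 0 = z₀ := by
    simp only [Y, orderedExp_self, intervalIntegral.integral_same, add_zero]; rfl
  rw [h0]
  abel

/-- Here `G(s) = U(s,t)` and `G' = -U(s,t) A(s)`; the boundary terms reduce to `n(t)` because
`U(t,t) = 1` and `n(0) = 0`. -/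
theorem tendsto_pathIntegral {n : ℝ → L2 w} (hn : ContinuousOn n (Set.Ici 0)) (hn0 : n 0 = 0)
    {t : ℝ} {m : ℕ → ℕ} {p : ℕ → ℕ → ℝ}
    (hp : ∀ j, Monotone (p j) ∧ p j 0 = 0 ∧ p j (m j) = t)
    (hmesh : ∀ δ > 0, ∀ᶠ j in atTop, ∀ i < m j, p j (i + 1) - p j i < δ) :
    Tendsto (fun j => ∑ i ∈ Finset.range (m j),
      evolution α β L w u (p j i) t (n (p j (i + 1)) - n (p j i))) atTop
      (𝓝 (pathIntegral α β L w u n t)) := by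
  obtain ⟨C, hC, hAC⟩ := exists_KPath_bound hα hβ hw hu
  have hA := continuous_KPath hα hβ hL hw hu
  have ht : 0 ≤ t := by
    rw [← (hp 0).2.1, ← (hp 0).2.2]; exact (hp 0).1 (Nat.zero_le _)
  have hn' : Continuous fun s => n (max s 0) := continuous_comp_max hn
  have key := tendsto_riemannSum (hasDerivAt_orderedExp_left hA hC hAC · t)
    ((continuous_orderedExp_left hA hC hAC t).mul hA).neg hn' hp hmesh
  have hlim : pathIntegral α β L w u n t =
      orderedExp (KPath α β L w u) t t (n (max t 0)) -
        orderedExp (KPath α β L w u) 0 t (n (max 0 0)) -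
        ∫ s in (0 : ℝ)..t, (-(orderedExp (KPath α β L w u) s t * KPath α β L w u s))
          (n (max s 0)) := by
    rw [pathIntegral_eq ht, orderedExp_self, max_self, hn0, map_zero, sub_zero]
    simp only [neg_apply, intervalIntegral.integral_neg, sub_neg_eq_add]
    rfl
  rw [hlim]
  refine key.congr fun j => Finset.sum_congr rfl fun i hi => ?_
  obtain ⟨hmono, h0, -⟩ := hp j
  have hi0 : ∀ i, 0 ≤ p j i := fun i => h0 ▸ hmono (Nat.zero_le i)
  rw [max_eq_left (hi0 _), max_eq_left (hi0 _), evolution_eq (hi0 i) ht]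

omit hL in
theorem exists_pathSolution_bound {T : ℝ} (hT : 0 ≤ T) :
    ∃ κ : ℝ, 0 < κ ∧ ∀ (z₀ : L2 w) (n : ℝ → L2 w) (B : ℝ),
      (∀ t ∈ Set.Icc 0 T, ‖n t‖ ≤ B) →
      ∀ t ∈ Set.Icc 0 T, ‖pathSolution α β L w u z₀ n t‖ ^ 2 ≤ κ * (‖z₀‖ ^ 2 + B ^ 2) := by
  obtain ⟨C, hC, hAC⟩ := exists_KPath_bound hα hβ hw hu
  set Γ : ℝ := Real.exp (C * T)
  have hΓ : ∀ s ∈ Set.Icc 0 T, ∀ t ∈ Set.Icc 0 T, ‖orderedExp (KPath α β L w u) s t‖ ≤ Γ := by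
    intro s hs t ht
    refine (norm_orderedExp_le hC hAC s t).trans (Real.exp_le_exp.2 ?_)
    have : |t - s| ≤ T := abs_sub_le_iff.2 ⟨by linarith [hs.1, ht.2], by linarith [hs.2, ht.1]⟩
    gcongr
  have hΓ0 : 0 < Γ := Real.exp_pos _
  -- The solution has norm at most `Γ ‖z₀‖ + (1 + Γ C T) B`; then `(a + b)² ≤ 2a² + 2b²`.
  refine ⟨2 * Γ ^ 2 + 2 * (1 + Γ * C * T) ^ 2, by positivity, fun z₀ n B hB t ht => ?_⟩
  have hB0 : 0 ≤ B := (norm_nonneg _).trans (hB t ht)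
  have h1 : ‖∫ s in (0 : ℝ)..t, orderedExp (KPath α β L w u) s t
      (KPath α β L w u s (n (max s 0)))‖ ≤ Γ * (C * B) * |t - 0| := by
    refine intervalIntegral.norm_integral_le_of_norm_le_const fun s hs => ?_
    rw [Set.uIoc_of_le ht.1] at hs
    have hs' : s ∈ Set.Icc 0 T := ⟨hs.1.le, hs.2.trans ht.2⟩
    rw [max_eq_left hs'.1]
    exact ContinuousLinearMap.le_of_opNorm_le_of_le _ (hΓ s hs' t ht)
      (ContinuousLinearMap.le_of_opNorm_le_of_le _ (hAC s) (hB s hs'))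
  have h2 : ‖pathSolution α β L w u z₀ n t‖ ≤ Γ * ‖z₀‖ + (1 + Γ * C * T) * B := by
    rw [pathSolution, pathIntegral_eq ht.1, evolution_eq le_rfl ht.1, max_eq_left ht.1]
    refine (norm_add_le _ _).trans (add_le_add
      (ContinuousLinearMap.le_of_opNorm_le _ (hΓ 0 ⟨le_rfl, hT⟩ t ht) z₀) ?_)
    refine (norm_add_le _ _).trans ((add_le_add (hB t ht) h1).trans ?_)
    rw [sub_zero, abs_of_nonneg ht.1]
    have : Γ * (C * B) * t ≤ Γ * (C * B) * T := mul_le_mul_of_nonneg_left ht.2 (by positivity)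
    linarith
  refine (pow_le_pow_left₀ (norm_nonneg _) h2 2).trans ?_
  have h3 : 0 ≤ 2 * Γ ^ 2 * B ^ 2 := by positivity
  have h4 : 0 ≤ 2 * (1 + Γ * C * T) ^ 2 * ‖z₀‖ ^ 2 := by positivity
  nlinarith [sq_nonneg (Γ * ‖z₀‖ - (1 + Γ * C * T) * B)]

end

/-! ### The strong solution -/

section Strong

variable {Ω : Type*} {mΩ : MeasurableSpace Ω} {M : ℝ → Ω → ℕ → ℝ} {Z₀ : Ω → L2 w}

theorem stronglyMeasurable_limUnder {Ω' : Type*} {m : MeasurableSpace Ω'} {g : ℕ → Ω' → L2 w}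
    (hg : ∀ j, StronglyMeasurable (g j)) :
    StronglyMeasurable fun ω => limUnder atTop fun j => g j ω :=
  StronglyMeasurable.limUnder hg

theorem stronglyMeasurable_toL2_input {s t : ℝ} (hs : s ∈ Set.Icc 0 t) :
    StronglyMeasurable[sigmaInput M Z₀ t] fun ω => toL2 w (M s ω) := by
  refine (stronglyMeasurable_toL2 w).comp_measurable (Measurable.of_comap_le ?_)
  exact le_sup_of_le_right (le_iSup₂_of_le s hs le_rfl)

theorem stronglyMeasurable_init_input (hZ₀ : StronglyMeasurable Z₀) (t : ℝ) :
    StronglyMeasurable[sigmaInput M Z₀ t] Z₀ := by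
  let _ : MeasurableSpace (L2 w) := borel (L2 w)
  have : BorelSpace (L2 w) := ⟨rfl⟩
  exact stronglyMeasurable_iff_measurable_separable.2
    ⟨Measurable.of_comap_le le_sup_left, hZ₀.isSeparable_range⟩

variable {P : Measure Ω} {ℱ : Filtration ℝ≥0 mΩ}

theorem IsDrivingMartingale.measurable (hM : IsDrivingMartingale α β L u P ℱ M) {t : ℝ}
    (ht : 0 ≤ t) : Measurable (M t) :=
  measurable_pi_iff.2 fun k =>
    (((hM.martingale k).stronglyMeasurable ⟨t, ht⟩).mono (ℱ.le _)).measurable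

theorem IsDrivingMartingale.sigmaInput_le (hM : IsDrivingMartingale α β L u P ℱ M)
    (hZ₀ : StronglyMeasurable Z₀) (t : ℝ) : sigmaInput M Z₀ t ≤ mΩ := by
  let _ : MeasurableSpace (L2 w) := borel (L2 w)
  have : BorelSpace (L2 w) := ⟨rfl⟩
  exact sup_le hZ₀.measurable.comap_le (iSup₂_le fun s hs => (hM.measurable hs.1).comap_le)

variable [IsProbabilityMeasure P] (hα : 0 < α) (hβ : 0 < β) (hL : 1 ≤ L) (hw : w.Comparable)
  (hu : IsLimitSolution α β L u) (h0 : AbsSummable w (u 0))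
  (hM : IsDrivingMartingale α β L u P ℱ M)

include hα hβ hL hw hu h0 hM

theorem hasStochasticIntegral_pathIntegral (t : ℝ) :
    HasStochasticIntegral P (fun s => evolution α β L w u s t) (fun s ω => toL2 w (M s ω)) t
      (fun ω => pathIntegral α β L w u (fun s => toL2 w (M s ω)) t) := by
  intro m p hp hmesh
  refine tendstoInMeasure_of_tendsto_ae (fun j => ?_) ?_
  · have hi0 : ∀ i, 0 ≤ p j i := fun i => (hp j).2.1 ▸ (hp j).1 (Nat.zero_le i)
    have hN : ∀ i, StronglyMeasurable fun ω => toL2 w (M (p j i) ω) := fun i =>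
      (stronglyMeasurable_toL2 w).comp_measurable (hM.measurable (hi0 i))
    exact (Finset.stronglyMeasurable_fun_sum _ fun i _ =>
      (evolution α β L w u (p j i) t).continuous.comp_stronglyMeasurable
        ((hN (i + 1)).sub (hN i))).aestronglyMeasurable
  · filter_upwards [hM.ae_path hu hα hβ hL hw h0] with ω hω
    exact tendsto_pathIntegral hα hβ hL hw hu hω.2.2 hω.2.1 hp hmesh

/-- Adaptedness is read off equidistant Riemann sums, which only involve `Z₀` and values of `M` at
times in `[0,t]`. -/
theorem aestronglyMeasurable_pathSolution (hZ₀ : StronglyMeasurable Z₀) {t : ℝ} (ht : 0 ≤ t) :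
    AEStronglyMeasurable[sigmaInput M Z₀ t]
      (fun ω => pathSolution α β L w u (Z₀ ω) (fun s => toL2 w (M s ω)) t) P := by
  let p : ℕ → ℕ → ℝ := fun j i => i / (j + 1 : ℕ) * t
  let m : ℕ → ℕ := fun j => j + 1
  have hp : ∀ j, Monotone (p j) ∧ p j 0 = 0 ∧ p j (m j) = t := fun j => by
    refine ⟨fun i i' h => ?_, by simp [p], ?_⟩
    · simp only [p]; gcongr
    · simp only [p, m]; rw [div_self (by positivity), one_mul]
  have hmesh : ∀ δ > 0, ∀ᶠ j in atTop, ∀ i < m j, p j (i + 1) - p j i < δ := fun δ hδ => by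
    have h1 : Tendsto (fun j : ℕ => 1 / ((j : ℝ) + 1) * t) atTop (𝓝 (0 * t)) :=
      tendsto_one_div_add_atTop_nhds_zero_nat.mul_const t
    rw [zero_mul] at h1
    filter_upwards [h1.eventually_lt_const hδ] with j hj i _
    refine lt_of_eq_of_lt ?_ hj
    simp only [p]
    push_cast
    ring
  let g : ℕ → Ω → L2 w := fun j ω => evolution α β L w u 0 t (Z₀ ω) +
    ∑ i ∈ Finset.range (m j), evolution α β L w u (p j i) t
      (toL2 w (M (p j (i + 1)) ω) - toL2 w (M (p j i) ω))
  have hg : ∀ j, StronglyMeasurable[sigmaInput M Z₀ t] (g j) := fun j => by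
    have hmem : ∀ i ≤ m j, p j i ∈ Set.Icc 0 t := fun i hi =>
      ⟨(hp j).2.1 ▸ (hp j).1 (Nat.zero_le i), ((hp j).1 hi).trans_eq (hp j).2.2⟩
    refine ((evolution α β L w u 0 t).continuous.comp_stronglyMeasurable
      (stronglyMeasurable_init_input hZ₀ t)).add
      (Finset.stronglyMeasurable_fun_sum _ fun i hi => ?_)
    rw [Finset.mem_range] at hi
    exact (evolution α β L w u (p j i) t).continuous.comp_stronglyMeasurable
      ((stronglyMeasurable_toL2_input (hmem (i + 1) hi)).sub
        (stronglyMeasurable_toL2_input (hmem i hi.le)))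
  -- `limUnder` is a representative measurable everywhere; it equals the solution wherever the sums
  -- converge to it.
  refine ⟨fun ω => limUnder atTop fun j => g j ω, stronglyMeasurable_limUnder hg, ?_⟩
  filter_upwards [hM.ae_path hu hα hβ hL hw h0] with ω hω
  exact (((tendsto_pathIntegral hα hβ hL hw hu hω.2.2 hω.2.1 hp hmesh).const_add
    (evolution α β L w u 0 t (Z₀ ω))).limUnder_eq).symm

theorem isStrongOUSolution_pathSolution (hZ₀ : StronglyMeasurable Z₀) :
    IsStrongOUSolution α β L w u P M Z₀
      (fun t ω => pathSolution α β L w u (Z₀ ω) (fun s => toL2 w (M s ω)) t) := by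
  have hpath := hM.ae_path hu hα hβ hL hw h0
  have had : ∀ t, 0 ≤ t → AEStronglyMeasurable[sigmaInput M Z₀ t]
      (fun ω => pathSolution α β L w u (Z₀ ω) (fun s => toL2 w (M s ω)) t) P := fun t ht =>
    aestronglyMeasurable_pathSolution hα hβ hL hw hu h0 hM hZ₀ ht
  refine ⟨⟨fun t ht => (had t ht).mono (hM.sigmaInput_le hZ₀ t), ?_, ?_, ?_⟩, had⟩
  · filter_upwards [hpath] with ω hω
    have := ((pathSolution_spec hα hβ hL hw hu hω.2.2 (Z₀ ω)).2 0 le_rfl).2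
    rwa [intervalIntegral.integral_same, hω.2.1, add_zero, add_zero] at this
  · filter_upwards [hpath] with ω hω t ht
    exact ((pathSolution_spec hα hβ hL hw hu hω.2.2 (Z₀ ω)).2 t ht).1
  · filter_upwards [hpath] with ω hω t ht
    have := ((pathSolution_spec hα hβ hL hw hu hω.2.2 (Z₀ ω)).2 t ht).2
    rw [this, L2.seq_add, L2.seq_add, hω.1 t ht]

theorem lintegral_sup_pathSolution_lt_top (hZ₀ : StronglyMeasurable Z₀)
    (hfin : ∫⁻ ω, ‖Z₀ ω‖ₑ ^ 2 ∂P < ⊤) {T : ℝ} (hT : 0 ≤ T) :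
    ∫⁻ ω, ⨆ t ∈ Set.Icc (0 : ℝ) T,
      ‖pathSolution α β L w u (Z₀ ω) (fun s => toL2 w (M s ω)) t‖ₑ ^ 2 ∂P < ⊤ := by
  obtain ⟨R, hR, hRint⟩ := hM.exists_sup_norm_majorant hu hα hβ hL hw h0 ⟨T, hT⟩
  obtain ⟨κ, hκ0, hκ⟩ := exists_pathSolution_bound hα hβ hw hu hT
  have hle : ∀ᵐ ω ∂P, ⨆ t ∈ Set.Icc (0 : ℝ) T,
      ‖pathSolution α β L w u (Z₀ ω) (fun s => toL2 w (M s ω)) t‖ₑ ^ 2 ≤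
      ENNReal.ofReal κ * (‖Z₀ ω‖ₑ ^ 2 + R ω) := by
    filter_upwards [hR] with ω hω
    refine iSup₂_le fun t ht => ?_
    -- Where `R` is infinite the bound is trivial, because `κ > 0`.
    by_cases htop : R ω = ⊤
    · rw [htop, add_top, ENNReal.mul_top (ENNReal.ofReal_pos.2 hκ0).ne']
      exact le_top
    · have hB : ∀ t ∈ Set.Icc 0 T, ‖toL2 w (M t ω)‖ ≤ Real.sqrt (R ω).toReal := fun t ht => by
        refine Real.le_sqrt_of_sq_le ?_
        rw [← ENNReal.ofReal_le_iff_le_toReal htop, ENNReal.ofReal_pow (norm_nonneg _),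
          ofReal_norm]
        exact hω t ht
      have h1 := hκ (Z₀ ω) (fun s => toL2 w (M s ω)) _ hB t ht
      rw [Real.sq_sqrt ENNReal.toReal_nonneg] at h1
      have h2 := ENNReal.ofReal_le_ofReal h1
      rwa [ENNReal.ofReal_pow (norm_nonneg _), ofReal_norm, ENNReal.ofReal_mul hκ0.le,
        ENNReal.ofReal_add (sq_nonneg _) ENNReal.toReal_nonneg, ENNReal.ofReal_toReal htop,
        ENNReal.ofReal_pow (norm_nonneg _), ofReal_norm] at h2
  refine (lintegral_mono_ae hle).trans_lt ?_
  -- Neither `R` nor the uncountable supremum needs to be measurable: the constant is finite, and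
  -- only the `Z₀` summand has to be measurable.
  rw [lintegral_const_mul' _ _ ENNReal.ofReal_ne_top, lintegral_add_left (hZ₀.enorm.pow_const 2)]
  exact ENNReal.mul_lt_top ENNReal.ofReal_lt_top (ENNReal.add_lt_top.2 ⟨hfin, hRint⟩)

end Strong

end SupermarketOU

/-! ### The theorem. -/

theorem theorem2p4 (α β : ℝ) (hα : 0 < α) (hβ : 0 < β) (L : ℕ) (hL : 1 ≤ L)
    (w : Weight) (hw : w.Comparable) :
    -- (a)
    (∃ C : ℝ, ∀ v ∈ tails,
      (∀ x : L2 w, (KOp α β L w v x).seq = Kseq α β L v x.seq) ∧ ‖KOp α β L w v‖ ≤ C) ∧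
    -- (b)
    (∀ u : ℝ → ℕ → ℝ, IsLimitSolution α β L u → SqSummable w (u 0) →
      (∀ z₀ : L2 w,
        (IsLinearizedSolution α β L w u (fun t => evolution α β L w u 0 t z₀) ∧
          evolution α β L w u 0 0 z₀ = z₀) ∧
        ∀ z : ℝ → L2 w, IsLinearizedSolution α β L w u z → z 0 = z₀ →
          ∀ t, 0 ≤ t → z t = evolution α β L w u 0 t z₀) ∧
      (∀ s t : ℝ, 0 ≤ s → s ≤ t →
        (∀ r ∈ Set.Icc s t, ∀ r' ∈ Set.Icc s t,
          Commute (KOp α β L w (u r)) (KOp α β L w (u r'))) →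
        evolution α β L w u s t = NormedSpace.exp (∫ r in s..t, KOp α β L w (u r))) ∧
      (∀ (Ω : Type*) (mΩ : MeasurableSpace Ω) (P : Measure Ω) (_ : IsProbabilityMeasure P)
        (ℱ : Filtration ℝ≥0 mΩ) (M : ℝ → Ω → ℕ → ℝ) (Z₀ : Ω → L2 w) (Z Z' : ℝ → Ω → L2 w),
        IsDrivingMartingale α β L u P ℱ M →
        IsOUSolution α β L w u P M Z₀ Z → IsOUSolution α β L w u P M Z₀ Z' →
        ∀ᵐ ω ∂P, ∀ t, 0 ≤ t → Z t ω = Z' t ω)) ∧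
    -- (c)
    (∀ u : ℝ → ℕ → ℝ, IsLimitSolution α β L u → AbsSummable w (u 0) →
      ∀ (Ω : Type*) (mΩ : MeasurableSpace Ω) (P : Measure Ω) (_ : IsProbabilityMeasure P)
        (ℱ : Filtration ℝ≥0 mΩ) (M : ℝ → Ω → ℕ → ℝ) (Z₀ : Ω → L2 w),
        IsDrivingMartingale α β L u P ℱ M → StronglyMeasurable Z₀ →
        ∃ Z : ℝ → Ω → L2 w,
          IsStrongOUSolution α β L w u P M Z₀ Z ∧
          (∀ᵐ ω ∂P, ContinuousOn (fun t => Z t ω) (Set.Ici 0)) ∧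
          (∀ Z' : ℝ → Ω → L2 w, IsOUSolution α β L w u P M Z₀ Z' →
            ∀ᵐ ω ∂P, ∀ t, 0 ≤ t → Z' t ω = Z t ω) ∧
          (∃ I : ℝ → Ω → L2 w,
            (∀ t, 0 ≤ t → HasStochasticIntegral P (fun s => evolution α β L w u s t)
              (fun s ω => toL2 w (M s ω)) t (I t)) ∧
            ∀ᵐ ω ∂P, ∀ t, 0 ≤ t → Z t ω = evolution α β L w u 0 t (Z₀ ω) + I t ω) ∧
          (∫⁻ ω, ‖Z₀ ω‖ₑ ^ 2 ∂P < ⊤ →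
            ∀ T : ℝ, 0 ≤ T → ∫⁻ ω, ⨆ t ∈ Set.Icc (0 : ℝ) T, ‖Z t ω‖ₑ ^ 2 ∂P < ⊤)) := by
  refine ⟨?_, fun u hu _ => ⟨fun z₀ => ⟨⟨?_, ?_⟩, ?_⟩, ?_, ?_⟩, ?_⟩
  · obtain ⟨C, _, hC⟩ := exists_KOp_bound (L := L) hα hβ hw
    exact ⟨C, hC⟩
  · exact isLinearizedSolution_evolution hα hβ hL hw hu z₀
  · exact evolution_self z₀
  · rintro z hz rfl t ht
    exact hz.eq_evolution hα hβ hL hw hu ht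
  · intro s t hs hst h
    exact evolution_of_commute hα hβ hL hw hu hs hst h
  · intro Ω mΩ P _ ℱ M Z₀ Z Z' _ hZ hZ'
    exact hZ.ae_eq hα hβ hL hw hu hZ'
  · intro u hu h0 Ω mΩ P _ ℱ M Z₀ hM hZ₀
    have hstrong := isStrongOUSolution_pathSolution hα hβ hL hw hu h0 hM hZ₀
    refine ⟨fun t ω => pathSolution α β L w u (Z₀ ω) (fun s => toL2 w (M s ω)) t, hstrong, ?_,
      fun Z' hZ' => hZ'.ae_eq hα hβ hL hw hu hstrong.toIsOUSolution,
      ⟨fun t ω => pathIntegral α β L w u (fun s => toL2 w (M s ω)) t,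
        fun t _ => hasStochasticIntegral_pathIntegral hα hβ hL hw hu h0 hM t,
        ae_of_all _ fun ω t _ => rfl⟩,
      fun hfin T hT => lintegral_sup_pathSolution_lt_top hα hβ hL hw hu h0 hM hZ₀ hfin hT⟩
    filter_upwards [hM.ae_path hu hα hβ hL hw h0] with ω hω
    exact (pathSolution_spec hα hβ hL hw hu hω.2.2 (Z₀ ω)).1
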